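/- Let $\mathbb K$ be $\mathbb R$ or $\mathbb C$; all spaces are Banach spaces over $\mathbb K$, operators are bounded and linear, and $B_Z$, $S_Z$ denote the closed unit ball and the unit sphere of $Z$. **Definitions.** For $K\subset X^*$ and $\varepsilon>0$ let $s_\varepsilon(K)$ be the set of those $x^*\in K$ such that $\operatorname{diam}(V\cap K)>\varepsilon$ (norm diameter) for every weak$^*$-neighbourhood $V$ of $x^*$; let $s_\varepsilon(K)=K$ for $\varepsilon\le 0$. A weak$^*$-compact set $K$ has *summable Szlenk index* if there is $M\ge 0$ such that $\sum_{i=1}^n\varepsilon_i\le M$ whenever $\varepsilon_1,\dots,\varepsilon_n\in\mathbb R$ and $s_{\varepsilon_1}\cdots s_{\varepsilon_n}(K)\ne\varnothing$. An operator $A:X\to Y$ has summable Szlenk index if $A^*B_{Y^*}$ does; a space $X$ has it if $B_{X^*}$ does. The injective tensor product $X_0\hat\otimes_\varepsilon X_1$ is the closed linear span, in the space of operators $X_1^*\to X_0$ with the operator norm, of the operators $x_0\otimes x_1: x^*\mapsto x^*(x_1)x_0$. For $A_i:X_i\to Y_i$ the operator $A_0\otimes A_1:X_0\hat\otimes_\varepsilon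 X_1\to Y_0\hat\otimes_\varepsilon Y_1$ is $u\mapsto A_0uA_1^*$. For a directed set $D$ and $n\ge 1$ let $D^{\le n}=\bigcup_{i=1}^nD^i$. A collection $(x_t)_{t\in D^{\le n}}\subset X$ is *weakly null* if for every sequence $t$ in $D$ of length less than $n$ (including the empty one) the net $(x_{t\smallfrown u})_{u\in D}$ is weakly null. Let $\{X\}_n$ be the set of norms $|\cdot|$ on $\mathbb K^n$ such that for each $b>1$ there are a directed set $D$ and a weakly null collection $(x_t)_{t\in D^{\le n}}\subset S_X$ with $b^{-1}\|\sum_{i=1}^n a_ix_{t|_i}\|\le|\sum_{i=1}^n a_ie_i|\le b\|\sum_{i=1}^n a_ix_{t|_i}\|$ for all $t\in D^n$ and all $a\in S_{\ell_\infty^n}$, where $t|_i$ is the initial segment of $t$ of length $i$. The space $X$ is *Asymptotic $c_0$* if $\dim X=\infty$ and there is $C\ge1$ such that $C^{-1}\|a\|_\infty\le|a|\le C\|a\|_\infty$ for all $n\ge 1$, all $|\cdot|\in\{X\}_n$ and all $a\in\mathbb K^n$. **Theorem.** Let $A_0:X_0\to Y_0$ and $A_1:X_1\to Y_1$ be operators.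 1. If $A_0$ and $A_1$ have summable Szlenk index, then so does $A_0\otimes A_1$. 2. If $A_0\ne0$, $A_1\neq 0$ and $A_0\otimes A_1$ has summable Szlenk index, then $A_0$ and $A_1$ have summable Szlenk index. 3. If $X_0$ and $X_1$ are non-zero, then $X_0\hat\otimes_\varepsilon X_1$ has summable Szlenk index if and only if both $X_0$ and $X_1$ do. 4. If $X_0$ and $X_1$ are non-zero and at least one of them is infinite-dimensional, then $X_0\hat\otimes_\varepsilon X_1$ is Asymptotic $c_0$ if and only if it has summable Szlenk index, and also if and only if each infinite-dimensional one among $X_0, X_1$ is Asymptotic $c_0$. (In particular, if both are infinite-dimensional, $X_0\hat\otimes_\varepsilon X_1$ is Asymptotic $c_0$ if and only if both $X_0$ and $X_1$ are.) -/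

import Mathlib

open Filter Topology

namespace SummableSzlenk

section Szlenk

variable {𝕜 : Type*} [RCLike 𝕜]
variable {X : Type*} [NormedAddCommGroup X] [NormedSpace 𝕜 X]
variable {Y : Type*} [NormedAddCommGroup Y] [NormedSpace 𝕜 Y]

/-- The derivation `s_ε(K)`: the points `x` of `K` all of whose weak-star neighbourhoods `V` satisfy
`diam (V ∩ K) > ε`, the diameter being taken in the dual norm; `s_ε(K) = K` when `ε ≤ 0`. -/
noncomputable def szlenkDeriv (ε : ℝ) (K : Set (WeakDual 𝕜 X)) : Set (WeakDual 𝕜 X) :=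
  if ε ≤ 0 then K
  else {x | x ∈ K ∧ ∀ V ∈ 𝓝 x,
    ENNReal.ofReal ε < Metric.ediam (WeakDual.toStrongDual '' (V ∩ K))}

/-- `K` has `M`-summable Szlenk index: `ε₁ + ⋯ + εₙ ≤ M` whenever
`s_{ε₁} (s_{ε₂} (⋯ s_{εₙ}(K)))` is non-empty. -/
def HasSummableSzlenkWith (M : ℝ) (K : Set (WeakDual 𝕜 X)) : Prop :=
  ∀ l : List ℝ, (l.foldr szlenkDeriv K).Nonempty → l.sum ≤ M

/-- A set of functionals has summable Szlenk index. -/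
def SetHasSummableSzlenk (K : Set (WeakDual 𝕜 X)) : Prop :=
  ∃ M : ℝ, 0 ≤ M ∧ HasSummableSzlenkWith M K

/-- The adjoint `A^* : Y^* → X^*`, `y^* ↦ y^* ∘ A`. -/
noncomputable def adjointCLM (A : X →L[𝕜] Y) : StrongDual 𝕜 Y →L[𝕜] StrongDual 𝕜 X :=
  ContinuousLinearMap.precomp 𝕜 A

/-- The set `A^* B_{Y^*}`, seen in `X^*` with its weak-star topology. -/
noncomputable def adjointBall (A : X →L[𝕜] Y) : Set (WeakDual 𝕜 X) :=
  (fun y : StrongDual 𝕜 Y => StrongDual.toWeakDual (adjointCLM A y)) ''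
    Metric.closedBall (0 : StrongDual 𝕜 Y) 1

/-- An operator `A : X → Y` has summable Szlenk index if `A^* B_{Y^*}` does. -/
def OpHasSummableSzlenk (A : X →L[𝕜] Y) : Prop :=
  SetHasSummableSzlenk (adjointBall A)

variable (𝕜 X) in
/-- The space `X` has summable Szlenk index if the dual unit ball `B_{X^*}` does. -/
def SpaceHasSummableSzlenk : Prop :=
  SetHasSummableSzlenk
    (StrongDual.toWeakDual '' Metric.closedBall (0 : StrongDual 𝕜 X) 1)

end Szlenk

section AsymptoticC0

universe u v

/-- Weakly null collections `(x_t)` indexed by the non-empty finite sequences in `D` of length at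
most `n`. Sequences are lists; the values of `x` at other lists are irrelevant. -/
def WeaklyNullTree (𝕜 : Type v) [RCLike 𝕜] {X : Type u} [NormedAddCommGroup X] [NormedSpace 𝕜 X]
    {D : Type u} [Preorder D] (n : ℕ) (x : List D → X) : Prop :=
  ∀ t : List D, t.length < n →
    Tendsto (fun d : D => toWeakSpace 𝕜 X (x (t ++ [d]))) atTop (𝓝 0)

/-- Membership of a norm `N` on `𝕜^n` in the asymptotic structure `{X}_n`: for every `b > 1` there
are a directed set `D` and a weakly null collection `(x_t)` of unit vectors such that along every
branch `t ∈ D^n` the vectors `x_{t|1}, …, x_{t|n}` are `b`-equivalent to the unit vector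
basis of `(𝕜^n, N)`. The norm of `Fin n → 𝕜` is the maximum norm. -/
def InAsymptoticStructure (𝕜 : Type v) [RCLike 𝕜] (X : Type u) [NormedAddCommGroup X]
    [NormedSpace 𝕜 X] (n : ℕ) (N : Seminorm 𝕜 (Fin n → 𝕜)) : Prop :=
  (∀ a, N a = 0 → a = 0) ∧
  ∀ b : ℝ, 1 < b →
    ∃ (D : Type u) (_ : Preorder D) (_ : IsDirectedOrder D) (_ : Nonempty D) (x : List D → X),
      (∀ t : List D, 1 ≤ t.length → t.length ≤ n → ‖x t‖ = 1) ∧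
      WeaklyNullTree 𝕜 n x ∧
      ∀ a : Fin n → 𝕜, ‖a‖ = 1 → ∀ t : List D, t.length = n →
        b⁻¹ * ‖∑ i : Fin n, a i • x (t.take (i + 1))‖ ≤ N a ∧
        N a ≤ b * ‖∑ i : Fin n, a i • x (t.take (i + 1))‖

/-- The space `X` is Asymptotic `c₀`: it is infinite-dimensional, and the norms in all its
asymptotic structures `{X}_n` are uniformly equivalent to the maximum norm. -/
def IsAsymptoticC0 (𝕜 : Type v) [RCLike 𝕜] (X : Type u) [NormedAddCommGroup X]
    [NormedSpace 𝕜 X] : Prop :=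
  ¬ FiniteDimensional 𝕜 X ∧
  ∃ C : ℝ, 1 ≤ C ∧ ∀ n : ℕ, 1 ≤ n → ∀ N : Seminorm 𝕜 (Fin n → 𝕜),
    InAsymptoticStructure 𝕜 X n N → ∀ a : Fin n → 𝕜, C⁻¹ * ‖a‖ ≤ N a ∧ N a ≤ C * ‖a‖

end AsymptoticC0

section Tensor

set_option maxSynthPendingDepth 3

variable (𝕜 : Type*) [RCLike 𝕜]
variable (X₀ X₁ : Type*) [NormedAddCommGroup X₀] [NormedSpace 𝕜 X₀]
  [NormedAddCommGroup X₁] [NormedSpace 𝕜 X₁]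
variable {𝕜 X₀ X₁}

/-- The elementary tensor `x₀ ⊗ x₁`, as the operator `X₁^* → X₀`, `f ↦ f(x₁) x₀`. -/
noncomputable def elemTensor (x₀ : X₀) (x₁ : X₁) : StrongDual 𝕜 X₁ →L[𝕜] X₀ :=
  (NormedSpace.inclusionInDoubleDual 𝕜 X₁ x₁).smulRight x₀

variable (𝕜 X₀ X₁) in
/-- The closed linear span of the elementary tensors in the space of bounded operators
`X₁^* → X₀`. -/
noncomputable def injTensorSubmodule : Submodule 𝕜 (StrongDual 𝕜 X₁ →L[𝕜] X₀) :=
  (Submodule.span 𝕜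
    (Set.range fun p : X₀ × X₁ => elemTensor (𝕜 := 𝕜) p.1 p.2)).topologicalClosure

variable (𝕜 X₀ X₁) in
/-- The injective tensor product of `X₀` and `X₁`: the closed linear span of the elementary tensors
in the space of bounded operators `X₁^* → X₀`, with the operator norm. -/
def InjTensor : Type _ := injTensorSubmodule 𝕜 X₀ X₁

noncomputable instance : NormedAddCommGroup (InjTensor 𝕜 X₀ X₁) :=
  inferInstanceAs (NormedAddCommGroup (injTensorSubmodule 𝕜 X₀ X₁))

noncomputable instance : NormedSpace 𝕜 (InjTensor 𝕜 X₀ X₁) :=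
  inferInstanceAs (NormedSpace 𝕜 (injTensorSubmodule 𝕜 X₀ X₁))

variable {Y₀ Y₁ : Type*} [NormedAddCommGroup Y₀] [NormedSpace 𝕜 Y₀]
  [NormedAddCommGroup Y₁] [NormedSpace 𝕜 Y₁]

/-- The operator `u ↦ A₀ ∘ u ∘ A₁^*` from `L(X₁^*, X₀)` to `L(Y₁^*, Y₀)`. -/
noncomputable def sandwich (A₀ : X₀ →L[𝕜] Y₀) (A₁ : X₁ →L[𝕜] Y₁) :
    (StrongDual 𝕜 X₁ →L[𝕜] X₀) →L[𝕜] (StrongDual 𝕜 Y₁ →L[𝕜] Y₀) :=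
  (ContinuousLinearMap.precomp Y₀ (adjointCLM A₁)).comp
    (ContinuousLinearMap.postcomp (StrongDual 𝕜 X₁) A₀)

theorem sandwich_apply (A₀ : X₀ →L[𝕜] Y₀) (A₁ : X₁ →L[𝕜] Y₁) (u : StrongDual 𝕜 X₁ →L[𝕜] X₀) :
    sandwich A₀ A₁ u = (A₀.comp u).comp (adjointCLM A₁) := rfl

theorem sandwich_elemTensor (A₀ : X₀ →L[𝕜] Y₀) (A₁ : X₁ →L[𝕜] Y₁) (x₀ : X₀) (x₁ : X₁) :
    sandwich A₀ A₁ (elemTensor x₀ x₁) = elemTensor (𝕜 := 𝕜) (A₀ x₀) (A₁ x₁) := by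
  ext f
  simp [sandwich_apply, elemTensor, adjointCLM]

theorem sandwich_mem (A₀ : X₀ →L[𝕜] Y₀) (A₁ : X₁ →L[𝕜] Y₁) (u : StrongDual 𝕜 X₁ →L[𝕜] X₀)
    (hu : u ∈ injTensorSubmodule 𝕜 X₀ X₁) :
    sandwich A₀ A₁ u ∈ injTensorSubmodule 𝕜 Y₀ Y₁ := by
  refine map_mem_closure (sandwich A₀ A₁).continuous hu fun v hv => ?_
  have hle : Submodule.span 𝕜 (Set.range fun p : X₀ × X₁ => elemTensor (𝕜 := 𝕜) p.1 p.2) ≤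
      (Submodule.span 𝕜 (Set.range fun p : Y₀ × Y₁ => elemTensor (𝕜 := 𝕜) p.1 p.2)).comap
        (sandwich A₀ A₁).toLinearMap := by
    rw [Submodule.span_le]
    rintro _ ⟨p, rfl⟩
    refine Submodule.subset_span ⟨(A₀ p.1, A₁ p.2), ?_⟩
    exact (sandwich_elemTensor A₀ A₁ p.1 p.2).symm
  exact hle hv

/-- The operator `A₀ ⊗ A₁` between the injective tensor products, `u ↦ A₀ ∘ u ∘ A₁^*`. -/
noncomputable def tensorMap (A₀ : X₀ →L[𝕜] Y₀) (A₁ : X₁ →L[𝕜] Y₁) :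
    InjTensor 𝕜 X₀ X₁ →L[𝕜] InjTensor 𝕜 Y₀ Y₁ :=
  ((sandwich A₀ A₁).comp (injTensorSubmodule 𝕜 X₀ X₁).subtypeL).codRestrict
    (injTensorSubmodule 𝕜 Y₀ Y₁) fun u => sandwich_mem A₀ A₁ u u.2

end Tensor

end SummableSzlenk

namespace SummableSzlenk

universe u v w

/-! ### Szlenk derivations: closedness, and distances near derived and underived points -/

section Derivation

variable {𝕜 : Type*} [RCLike 𝕜]
variable {X : Type*} [NormedAddCommGroup X] [NormedSpace 𝕜 X]

/-! Summability of the Szlenk index is a property of weakly null trees: an operator `A` has it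
exactly when, for some `C`, every weakly null tree of finite height in the unit ball has a branch
whose sum is mapped by `A` to a vector of norm at most `C` (`OpHasSummableSzlenk.exists_tree_bound`,
`opHasSummableSzlenk_of_tree_bound`).

From derivations to trees (`exists_mem_foldr_szlenkDeriv_of_tree`): suppose that on every branch
some functional of a weak-star compact set is large. Going from the leaves to the root, pass at each
node to a weak-star limit. The norm distance to the limit is controlled by the largest `ε` for which
the limit survives `s_ε`, so the total loss is at most the sum of these `ε`, up to rounding. The
argument is run for pairs `(f, g)` from two compact sets and a Lipschitz, weak-star continuous `T f
g`. With `T f g = f ⊗ g`, which norms `A₀ ⊗ A₁` on the injective tensor product, part 1 follows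
without deriving any set of functionals on the tensor product.

From trees to derivations (`exists_tree_of_mem_foldr_szlenkDeriv`): a point of `s_ε(K)` is a limit
of points of `K` differing from it by at least `ε / 8` on unit vectors of any prescribed
finite-codimensional subspace. Iterating builds a weakly null tree whose branch sums are at least
about one eighth of the sum of the `ε`.

Part 2 follows since `x ↦ x ⊗ x₁` and `x ↦ x₀ ⊗ x` transfer tree bounds
(`OpHasSummableSzlenk.of_norm_le`), and part 3 is the case of identities. For part 4, ultrafilter
limits along branches turn trees into norms of the asymptotic structure; the lower `c₀` estimate is
automatic, so only the upper one matters, and that is the tree bound. -/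

theorem szlenkDeriv_of_nonpos {ε : ℝ} (hε : ε ≤ 0) (K : Set (WeakDual 𝕜 X)) :
    szlenkDeriv ε K = K := if_pos hε

theorem mem_szlenkDeriv_of_pos {ε : ℝ} (hε : 0 < ε) {K : Set (WeakDual 𝕜 X)} {f : WeakDual 𝕜 X} :
    f ∈ szlenkDeriv ε K ↔ f ∈ K ∧ ∀ V ∈ 𝓝 f,
      ENNReal.ofReal ε < Metric.ediam (WeakDual.toStrongDual '' (V ∩ K)) := by
  rw [szlenkDeriv, if_neg hε.not_ge]
  rfl

theorem szlenkDeriv_subset (ε : ℝ) (K : Set (WeakDual 𝕜 X)) : szlenkDeriv ε K ⊆ K := by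
  intro f hf
  rcases le_or_gt ε 0 with hε | hε
  · rwa [szlenkDeriv_of_nonpos hε] at hf
  · exact ((mem_szlenkDeriv_of_pos hε).1 hf).1

theorem foldr_szlenkDeriv_subset (l : List ℝ) (K : Set (WeakDual 𝕜 X)) :
    l.foldr szlenkDeriv K ⊆ K := by
  induction l with
  | nil => exact subset_rfl
  | cons ε l ih => exact (szlenkDeriv_subset ε _).trans ih

theorem isClosed_szlenkDeriv {K : Set (WeakDual 𝕜 X)} (hK : IsClosed K) (ε : ℝ) :
    IsClosed (szlenkDeriv ε K) := by
  rcases le_or_gt ε 0 with hε | hε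
  · rwa [szlenkDeriv_of_nonpos hε]
  refine isClosed_of_closure_subset fun f hf => ?_
  refine (mem_szlenkDeriv_of_pos hε).2
    ⟨hK.closure_subset_iff.2 (szlenkDeriv_subset ε K) hf, fun V hV => ?_⟩
  obtain ⟨V', hV'V, hV', hfV'⟩ := mem_nhds_iff.1 hV
  obtain ⟨g, hgV', hg⟩ := mem_closure_iff.1 hf V' hV' hfV'
  refine (((mem_szlenkDeriv_of_pos hε).1 hg).2 V' (hV'.mem_nhds hgV')).trans_le ?_
  exact Metric.ediam_mono (Set.image_mono (Set.inter_subset_inter_left _ hV'V))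

theorem isClosed_foldr_szlenkDeriv {K : Set (WeakDual 𝕜 X)} (hK : IsClosed K) (l : List ℝ) :
    IsClosed (l.foldr szlenkDeriv K) := by
  induction l with
  | nil => exact hK
  | cons ε l ih => exact isClosed_szlenkDeriv ih ε

/-- Dropping the non-positive numbers does not change an iterated derivation. -/
theorem foldr_szlenkDeriv_filter_pos (l : List ℝ) (K : Set (WeakDual 𝕜 X)) :
    (l.filter (0 < ·)).foldr szlenkDeriv K = l.foldr szlenkDeriv K := by
  induction l with
  | nil => rfl
  | cons ε l ih =>
    by_cases hε : 0 < ε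
    · simp [hε, ih]
    · simp [hε, ih, szlenkDeriv_of_nonpos (not_lt.1 hε)]

theorem sum_le_sum_filter_pos (l : List ℝ) : l.sum ≤ (l.filter (0 < ·)).sum := by
  induction l with
  | nil => simp
  | cons ε l ih =>
    by_cases hε : 0 < ε
    · simpa [hε] using ih
    · simp only [List.sum_cons, hε, decide_false, Bool.false_eq_true, not_false_eq_true,
        List.filter_cons_of_neg]
      linarith

/-- A point outside `s_ε(K)` has a neighbourhood in `K` that lies in the `ε`-ball about it. -/
theorem eventually_norm_sub_le_of_notMem_szlenkDeriv {ε : ℝ} (hε : 0 < ε)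
    {K : Set (WeakDual 𝕜 X)} {f : WeakDual 𝕜 X} (hf : f ∈ K) (hfs : f ∉ szlenkDeriv ε K) :
    ∀ᶠ g in 𝓝 f, g ∈ K → ‖WeakDual.toStrongDual g - WeakDual.toStrongDual f‖ ≤ ε := by
  rw [mem_szlenkDeriv_of_pos hε] at hfs
  push Not at hfs
  obtain ⟨V, hV, hd⟩ := hfs hf
  filter_upwards [hV] with g hg hgK
  have := (Metric.edist_le_ediam_of_mem (Set.mem_image_of_mem WeakDual.toStrongDual
    (show g ∈ V ∩ K from ⟨hg, hgK⟩)) (Set.mem_image_of_mem WeakDual.toStrongDual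
    (show f ∈ V ∩ K from ⟨mem_of_mem_nhds hV, hf⟩))).trans hd
  rwa [edist_dist, ENNReal.ofReal_le_ofReal_iff hε.le, dist_eq_norm] at this

/-- Points of `s_ε(K)` are weak-star cluster points of elements of `K` at distance more than
`ε / 2`. -/
theorem frequently_lt_norm_sub_of_mem_szlenkDeriv {ε : ℝ} (hε : 0 < ε)
    {K : Set (WeakDual 𝕜 X)} {f : WeakDual 𝕜 X} (hf : f ∈ szlenkDeriv ε K) :
    ∃ᶠ g in 𝓝 f, g ∈ K ∧ ε / 2 < ‖WeakDual.toStrongDual g - WeakDual.toStrongDual f‖ := by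
  intro h
  have hd := ((mem_szlenkDeriv_of_pos hε).1 hf).2 _ h
  refine absurd hd (not_lt.2 (Metric.ediam_le ?_))
  rintro _ ⟨g, ⟨hg, hgK⟩, rfl⟩ _ ⟨g', ⟨hg', hgK'⟩, rfl⟩
  have h1 : ‖WeakDual.toStrongDual g - WeakDual.toStrongDual f‖ ≤ ε / 2 :=
    not_lt.1 fun h' => hg ⟨hgK, h'⟩
  have h2 : ‖WeakDual.toStrongDual g' - WeakDual.toStrongDual f‖ ≤ ε / 2 :=
    not_lt.1 fun h' => hg' ⟨hgK', h'⟩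
  rw [edist_dist]
  refine ENNReal.ofReal_le_ofReal ?_
  rw [← dist_eq_norm] at h1 h2
  linarith [dist_triangle_right (WeakDual.toStrongDual g) (WeakDual.toStrongDual g')
    (WeakDual.toStrongDual f)]

end Derivation

/-! ### Branch sums and weakly null trees -/

section BranchSum

variable {E : Type*} [NormedAddCommGroup E] {D : Type*}

/-- The sum of a collection along the branch `t`. -/
def branchSum (n : ℕ) (x : List D → E) (t : List D) : E :=
  ∑ i : Fin n, x (t.take (i + 1))

theorem branchSum_zero (x : List D → E) (t : List D) : branchSum 0 x t = 0 := by
  simp [branchSum]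

theorem branchSum_cons (n : ℕ) (x : List D → E) (d : D) (t : List D) :
    branchSum (n + 1) x (d :: t) = x [d] + branchSum n (fun t => x (d :: t)) t := by
  simp [branchSum, Fin.sum_univ_succ]

end BranchSum

section Trees

variable {𝕜 : Type*} [RCLike 𝕜]
variable {E : Type*} [NormedAddCommGroup E] [NormedSpace 𝕜 E]

theorem tendsto_toWeakSpace_zero_iff {α : Type*} {l : Filter α} {x : α → E} :
    Tendsto (fun a => toWeakSpace 𝕜 E (x a)) l (𝓝 0) ↔
      ∀ f : StrongDual 𝕜 E, Tendsto (fun a => f (x a)) l (𝓝 0) := by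
  have hinj : Function.Injective (topDualPairing 𝕜 E).flip := by
    refine (injective_iff_map_eq_zero _).2 fun v hv => ?_
    by_contra hne
    obtain ⟨f, -, hf⟩ := exists_dual_vector 𝕜 v (norm_ne_zero_iff.2 hne)
    have : f v = 0 := LinearMap.congr_fun hv f
    rw [hf] at this
    simp_all
  have h := WeakBilin.tendsto_iff_forall_eval_tendsto (B := (topDualPairing 𝕜 E).flip)
    (l := l) (f := fun a => (toWeakSpace 𝕜 E (x a))) (x := (0 : WeakSpace 𝕜 E)) hinj
  refine h.trans (forall_congr' fun f => ?_)
  have h0 : (topDualPairing 𝕜 E).flip (0 : WeakSpace 𝕜 E) f = 0 := map_zero f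
  rw [h0]
  rfl

variable {D : Type*} [Preorder D]

variable (𝕜) in
/-- `WeaklyNullTree` expressed through functionals, for index sets in an arbitrary universe. -/
def IsWeaklyNullTree (n : ℕ) (x : List D → E) : Prop :=
  ∀ t : List D, t.length < n → ∀ f : StrongDual 𝕜 E,
    Tendsto (fun d : D => f (x (t ++ [d]))) atTop (𝓝 0)

theorem IsWeaklyNullTree.cons {n : ℕ} {x : List D → E} (hx : IsWeaklyNullTree 𝕜 (n + 1) x)
    (d : D) : IsWeaklyNullTree 𝕜 n fun t => x (d :: t) :=
  fun t ht f => hx (d :: t) (by simpa using ht) f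

theorem IsWeaklyNullTree.root {n : ℕ} {x : List D → E} (hx : IsWeaklyNullTree 𝕜 (n + 1) x)
    (f : StrongDual 𝕜 E) : Tendsto (fun d => f (x [d])) atTop (𝓝 0) :=
  hx [] (by simp) f

theorem weaklyNullTree_iff {E D : Type u} [NormedAddCommGroup E] [NormedSpace 𝕜 E]
    [Preorder D] {n : ℕ} {x : List D → E} :
    WeaklyNullTree 𝕜 n x ↔ IsWeaklyNullTree 𝕜 n x :=
  forall₂_congr fun _ _ => tendsto_toWeakSpace_zero_iff

end Trees

/-! ### From derivations to trees: limits of functionals from the leaves to the root -/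

section TreeBound

variable {𝕜 : Type*} [RCLike 𝕜]

/-- Summability caps the admissible multiples of `δ`. Maximality of `k` yields a neighbourhood of
`f` on which the derived set lies within `(k + 1)δ` of `f`. -/
theorem HasSummableSzlenkWith.exists_maximal_multiple {X : Type*} [NormedAddCommGroup X]
    [NormedSpace 𝕜 X] {M : ℝ} {K : Set (WeakDual 𝕜 X)} (hM : HasSummableSzlenkWith M K)
    {δ : ℝ} (hδ : 0 < δ) {l : List ℝ} {f : WeakDual 𝕜 X} (hf : f ∈ l.foldr szlenkDeriv K) :
    ∃ k : ℕ, f ∈ szlenkDeriv (k * δ) (l.foldr szlenkDeriv K) ∧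
      f ∉ szlenkDeriv ((k + 1 : ℕ) * δ) (l.foldr szlenkDeriv K) := by
  by_contra! h
  have hall : ∀ k : ℕ, f ∈ szlenkDeriv (k * δ) (l.foldr szlenkDeriv K) := by
    intro k
    induction k with
    | zero => rwa [szlenkDeriv_of_nonpos (by simp)]
    | succ k ih => exact h k ih
  obtain ⟨k, hk⟩ := exists_nat_gt ((M - l.sum) / δ)
  have := hM ((k * δ) :: l) ⟨f, hall k⟩
  rw [div_lt_iff₀ hδ] at hk
  rw [List.sum_cons] at this
  linarith

theorem finite_lists_length_sum (n N : ℕ) : {l : List ℕ | l.length = n ∧ l.sum ≤ N}.Finite := by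
  refine ((List.finite_length_eq (Fin (N + 1)) n).image (List.map Fin.val)).subset ?_
  rintro l ⟨hl, hs⟩
  refine ⟨l.map (Fin.ofNat (N + 1)), by simpa using hl, ?_⟩
  rw [List.map_map]
  conv_rhs => rw [← List.map_id l]
  refine List.map_congr_left fun a ha => ?_
  have := List.le_sum_of_mem ha
  simp only [Function.comp_apply, Fin.val_ofNat, id_eq]
  exact Nat.mod_eq_of_lt (by omega)

variable {E : Type*} [NormedAddCommGroup E] [NormedSpace 𝕜 E]
variable {X₀ X₁ : Type*} [NormedAddCommGroup X₀] [NormedSpace 𝕜 X₀]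
  [NormedAddCommGroup X₁] [NormedSpace 𝕜 X₁]
variable {D : Type*} [Preorder D] [IsDirectedOrder D] [Nonempty D]

theorem sum_map_mul_const (l : List ℕ) (δ : ℝ) :
    (l.map fun k : ℕ => (k * δ : ℝ)).sum = l.sum * δ := by
  induction l with
  | nil => simp
  | cons k l ih => simp [ih, add_mul]

/-- Rounding to multiples of `δ` leaves finitely many lists, so an ultrafilter selects one: this
makes all children of a node share the same iterated derivation. -/
theorem exists_eventually_eq_of_sum_le {α : Type*} (U : Ultrafilter α) (l : α → List ℕ) {n : ℕ}
    (hl : ∀ a, (l a).length = n) {δ M : ℝ} (hδ : 0 < δ) (hM : ∀ a, (l a).sum * δ ≤ M) :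
    ∃ l' : List ℕ, l'.length = n ∧ ∀ᶠ a in (U : Filter α), l a = l' := by
  have hfin := finite_lists_length_sum n ⌊M / δ⌋₊
  have h : ∀ᶠ a in (U : Filter α), ∃ l' ∈ {l : List ℕ | l.length = n ∧ l.sum ≤ ⌊M / δ⌋₊},
      l a = l' := Eventually.of_forall fun a =>
    ⟨l a, ⟨hl a, Nat.le_floor ((le_div_iff₀ hδ).2 (hM a))⟩, rfl⟩
  obtain ⟨l', hl', h'⟩ := (Ultrafilter.eventually_exists_mem_iff hfin).1 h
  exact ⟨l', hl'.1, h'⟩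

/-- Functionals that are large along all branches of a weakly null tree force an iterated
derivation to be non-empty. -/
theorem exists_mem_foldr_szlenkDeriv_of_tree {K₀ : Set (WeakDual 𝕜 X₀)}
    {K₁ : Set (WeakDual 𝕜 X₁)} (hK₀ : IsCompact K₀) (hK₁ : IsCompact K₁) {M₀ M₁ : ℝ}
    (hM₀ : HasSummableSzlenkWith M₀ K₀) (hM₁ : HasSummableSzlenkWith M₁ K₁)
    {T : WeakDual 𝕜 X₀ → WeakDual 𝕜 X₁ → StrongDual 𝕜 E} {R : ℝ} (hR : 0 ≤ R)
    (hT : ∀ f ∈ K₀, ∀ f' ∈ K₀, ∀ g ∈ K₁, ∀ g' ∈ K₁, ‖T f g - T f' g'‖ ≤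
      R * (‖WeakDual.toStrongDual f - WeakDual.toStrongDual f'‖ +
        ‖WeakDual.toStrongDual g - WeakDual.toStrongDual g'‖))
    (hTc : ∀ e : E, ContinuousOn (fun p : WeakDual 𝕜 X₀ × WeakDual 𝕜 X₁ => T p.1 p.2 e)
      (K₀ ×ˢ K₁)) {δ : ℝ} (hδ : 0 < δ) (n : ℕ) :
    ∀ x : List D → E, (∀ t, 1 ≤ t.length → t.length ≤ n → ‖x t‖ ≤ 1) → IsWeaklyNullTree 𝕜 n x →
    ∀ (z : E) (c : ℝ), (∀ t, t.length = n → ∃ f ∈ K₀, ∃ g ∈ K₁,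
      c ≤ RCLike.re (T f g (z + branchSum n x t))) →
    ∃ l₀ l₁ : List ℕ, l₀.length = n ∧ l₁.length = n ∧
      ∃ f ∈ (l₀.map fun k : ℕ => (k * δ : ℝ)).foldr szlenkDeriv K₀,
      ∃ g ∈ (l₁.map fun k : ℕ => (k * δ : ℝ)).foldr szlenkDeriv K₁,
      c ≤ RCLike.re (T f g z) + R * δ * (l₀.sum + l₁.sum) + n * (2 * R * δ) := by
  induction n with
  | zero =>
    intro x _ _ z c h
    obtain ⟨f, hf, g, hg, hc⟩ := h [] rfl
    exact ⟨[], [], rfl, rfl, f, hf, g, hg, by simpa [branchSum_zero] using hc⟩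
  | succ n ih =>
    intro x hx1 hx z c h
    -- The root vector is absorbed into the base point, leaving a tree of height `n` above `d`.
    have step := fun d => ih (fun t => x (d :: t))
      (fun t _ h2 => hx1 (d :: t) (by simp) (by simpa using h2)) (hx.cons d) (z + x [d]) c
      (fun t ht => by
        obtain ⟨f, hf, g, hg, hc⟩ := h (d :: t) (by simpa using ht)
        exact ⟨f, hf, g, hg, by rwa [branchSum_cons, ← add_assoc] at hc⟩)
    choose l₀ l₁ hl₀ hl₁ f hf g hg hc using step
    set U : Ultrafilter D := Ultrafilter.of atTop
    have hU : (U : Filter D) ≤ atTop := Ultrafilter.of_le _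
    obtain ⟨l₀', hl₀', he₀⟩ := exists_eventually_eq_of_sum_le U l₀ hl₀ hδ fun d => by
      simpa only [sum_map_mul_const] using hM₀ _ ⟨f d, hf d⟩
    obtain ⟨l₁', hl₁', he₁⟩ := exists_eventually_eq_of_sum_le U l₁ hl₁ hδ fun d => by
      simpa only [sum_map_mul_const] using hM₁ _ ⟨g d, hg d⟩
    set L₀ := (l₀'.map fun k : ℕ => (k * δ : ℝ)).foldr szlenkDeriv K₀ with hL₀
    set L₁ := (l₁'.map fun k : ℕ => (k * δ : ℝ)).foldr szlenkDeriv K₁ with hL₁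
    have hfL : ∀ᶠ d in (U : Filter D), f d ∈ L₀ := he₀.mono fun d hd => by
      have := hf d
      rwa [hd] at this
    have hgL : ∀ᶠ d in (U : Filter D), g d ∈ L₁ := he₁.mono fun d hd => by
      have := hg d
      rwa [hd] at this
    have hsub₀ : L₀ ⊆ K₀ := foldr_szlenkDeriv_subset _ _
    have hsub₁ : L₁ ⊆ K₁ := foldr_szlenkDeriv_subset _ _
    have hcpt₀ : IsCompact L₀ := hK₀.of_isClosed_subset
      (isClosed_foldr_szlenkDeriv hK₀.isClosed _) hsub₀
    have hcpt₁ : IsCompact L₁ := hK₁.of_isClosed_subset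
      (isClosed_foldr_szlenkDeriv hK₁.isClosed _) hsub₁
    -- The derived sets are weak-star compact, so the limits of the children's functionals stay in
    -- them.
    obtain ⟨f', hf', hlimf⟩ := hcpt₀.ultrafilter_le_nhds (U.map f) (le_principal_iff.2 hfL)
    obtain ⟨g', hg', hlimg⟩ := hcpt₁.ultrafilter_le_nhds (U.map g) (le_principal_iff.2 hgL)
    replace hlimf : Tendsto f U (𝓝 f') := hlimf
    replace hlimg : Tendsto g U (𝓝 g') := hlimg
    obtain ⟨k₀, hk₀, hk₀'⟩ := hM₀.exists_maximal_multiple hδ hf'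
    obtain ⟨k₁, hk₁, hk₁'⟩ := hM₁.exists_maximal_multiple hδ hg'
    -- The root contributes the outermost derivation, hence the head of each list.
    refine ⟨k₀ :: l₀', k₁ :: l₁', by simp [hl₀'], by simp [hl₁'], f', hk₀, g', hk₁, ?_⟩
    have hnf := hlimf.eventually
      (eventually_norm_sub_le_of_notMem_szlenkDeriv (by positivity) hf' hk₀')
    have hng := hlimg.eventually
      (eventually_norm_sub_le_of_notMem_szlenkDeriv (by positivity) hg' hk₁')
    -- Replacing `f d, g d` by the limits costs `R((k₀ + 1)δ + (k₁ + 1)δ)` on `x [d]`; then the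
    -- fixed functional `T f' g'` tends to zero on the root vectors.
    have hlim : Tendsto (fun d => RCLike.re (T (f d) (g d) z) + RCLike.re (T f' g' (x [d]))
        + (R * (((k₀ + 1 : ℕ) : ℝ) * δ + ((k₁ + 1 : ℕ) : ℝ) * δ)
          + R * δ * (l₀'.sum + l₁'.sum) + n * (2 * R * δ))) U
        (𝓝 (RCLike.re (T f' g' z) + RCLike.re (0 : 𝕜)
        + (R * (((k₀ + 1 : ℕ) : ℝ) * δ + ((k₁ + 1 : ℕ) : ℝ) * δ)
          + R * δ * (l₀'.sum + l₁'.sum) + n * (2 * R * δ)))) := by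
      refine Tendsto.add (Tendsto.add ?_ ?_) tendsto_const_nhds
      · refine (RCLike.continuous_re.tendsto _).comp ?_
        refine Tendsto.comp (f := fun d => (f d, g d))
          (g := fun p : WeakDual 𝕜 X₀ × WeakDual 𝕜 X₁ => T p.1 p.2 z)
          (hTc z (f', g') ⟨hsub₀ hf', hsub₁ hg'⟩) ?_
        refine tendsto_nhdsWithin_iff.2 ⟨hlimf.prodMk_nhds hlimg, ?_⟩
        filter_upwards [hfL, hgL] with d h1 h2 using ⟨hsub₀ h1, hsub₁ h2⟩
      · exact (RCLike.continuous_re.tendsto _).comp ((hx.root (T f' g')).mono_left hU)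
    have hle : c ≤ RCLike.re (T f' g' z) + RCLike.re (0 : 𝕜)
        + (R * (((k₀ + 1 : ℕ) : ℝ) * δ + ((k₁ + 1 : ℕ) : ℝ) * δ)
          + R * δ * (l₀'.sum + l₁'.sum) + n * (2 * R * δ)) := by
      refine ge_of_tendsto hlim ?_
      filter_upwards [he₀, he₁, hnf, hng, hfL, hgL] with d h0 h1 h2 h3 h4 h5
      have hcd := hc d
      rw [h0, h1, map_add, map_add] at hcd
      have hdiff : RCLike.re (T (f d) (g d) (x [d])) - RCLike.re (T f' g' (x [d])) ≤
          R * (((k₀ + 1 : ℕ) : ℝ) * δ + ((k₁ + 1 : ℕ) : ℝ) * δ) := by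
        calc RCLike.re (T (f d) (g d) (x [d])) - RCLike.re (T f' g' (x [d]))
            = RCLike.re ((T (f d) (g d) - T f' g') (x [d])) := by simp
          _ ≤ ‖(T (f d) (g d) - T f' g') (x [d])‖ := RCLike.re_le_norm _
          _ ≤ ‖T (f d) (g d) - T f' g'‖ * 1 :=
            ContinuousLinearMap.le_opNorm_of_le _ (hx1 [d] (by simp) (by simp))
          _ ≤ _ := by
            rw [mul_one]
            refine (hT _ (hsub₀ h4) _ (hsub₀ hf') _ (hsub₁ h5) _ (hsub₁ hg')).trans ?_
            exact mul_le_mul_of_nonneg_left (add_le_add (h2 h4) (h3 h5)) hR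
      linarith
    refine hle.trans_eq ?_
    simp only [map_zero, List.sum_cons]
    push_cast
    ring

/-- A weakly null tree in the unit ball has a branch along which the functionals `T f g` are
bounded by the sums of the derivations. -/
theorem exists_branch_re_le {K₀ : Set (WeakDual 𝕜 X₀)}
    {K₁ : Set (WeakDual 𝕜 X₁)} (hK₀ : IsCompact K₀) (hK₁ : IsCompact K₁) {M₀ M₁ : ℝ}
    (hM₀ : HasSummableSzlenkWith M₀ K₀) (hM₁ : HasSummableSzlenkWith M₁ K₁)
    {T : WeakDual 𝕜 X₀ → WeakDual 𝕜 X₁ → StrongDual 𝕜 E} {R : ℝ} (hR : 0 ≤ R)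
    (hT : ∀ f ∈ K₀, ∀ f' ∈ K₀, ∀ g ∈ K₁, ∀ g' ∈ K₁, ‖T f g - T f' g'‖ ≤
      R * (‖WeakDual.toStrongDual f - WeakDual.toStrongDual f'‖ +
        ‖WeakDual.toStrongDual g - WeakDual.toStrongDual g'‖))
    (hTc : ∀ e : E, ContinuousOn (fun p : WeakDual 𝕜 X₀ × WeakDual 𝕜 X₁ => T p.1 p.2 e)
      (K₀ ×ˢ K₁)) {n : ℕ} {x : List D → E}
    (hx1 : ∀ t, 1 ≤ t.length → t.length ≤ n → ‖x t‖ ≤ 1) (hx : IsWeaklyNullTree 𝕜 n x) :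
    ∃ t, t.length = n ∧ ∀ f ∈ K₀, ∀ g ∈ K₁,
      RCLike.re (T f g (branchSum n x t)) ≤ R * (M₀ + M₁) + 2 * R + 1 := by
  by_contra! h
  -- With `δ = 1 / (n + 1)` the rounding loss `n * 2Rδ` stays below `2R`, independently of the
  -- height.
  obtain ⟨l₀, l₁, -, -, f, hf, g, hg, hc⟩ := exists_mem_foldr_szlenkDeriv_of_tree hK₀ hK₁ hM₀ hM₁
    hR hT hTc (δ := 1 / (n + 1)) (by positivity) n x hx1 hx 0 (R * (M₀ + M₁) + 2 * R + 1)
    (fun t ht => by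
      obtain ⟨f, hf, g, hg, h'⟩ := h t ht
      exact ⟨f, hf, g, hg, by rw [zero_add]; exact h'.le⟩)
  have h0 := hM₀ _ ⟨f, hf⟩
  have h1 := hM₁ _ ⟨g, hg⟩
  rw [sum_map_mul_const] at h0 h1
  have h2 : R * (1 / (n + 1)) * (l₀.sum + l₁.sum) ≤ R * (M₀ + M₁) := by
    rw [mul_assoc]
    refine mul_le_mul_of_nonneg_left ?_ hR
    linarith
  have h3 : n * (2 * R * (1 / (n + 1 : ℝ))) ≤ 2 * R := by
    rw [mul_one_div, ← mul_div_assoc, div_le_iff₀ (by positivity)]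
    nlinarith
  simp only [map_zero] at hc
  linarith

end TreeBound

/-! ### From derivations to trees of unit vectors with large branch sums -/

section TreeOfDerivation

variable {𝕜 : Type*} [RCLike 𝕜]
variable {X : Type u} [NormedAddCommGroup X] [NormedSpace 𝕜 X]

/-- A functional whose real part is at most `c` on the unit sphere of `Z` is, up to a functional
of norm at most `c`, zero on `Z`. -/
theorem exists_norm_le_of_re_le (f : StrongDual 𝕜 X) (Z : Submodule 𝕜 X) {c : ℝ} (hc : 0 ≤ c)
    (h : ∀ x ∈ Z, ‖x‖ = 1 → RCLike.re (f x) ≤ c) :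
    ∃ g : StrongDual 𝕜 X, ‖g‖ ≤ c ∧ ∀ x ∈ Z, (f - g) x = 0 := by
  obtain ⟨g, hg, hgn⟩ := exists_extension_norm_eq Z (f.comp Z.subtypeL)
  refine ⟨g, ?_, fun x hx => ?_⟩
  · rw [hgn]
    refine ContinuousLinearMap.opNorm_le_bound _ hc fun ⟨x, hx⟩ => ?_
    change ‖f x‖ ≤ c * ‖x‖
    rcases eq_or_ne x 0 with rfl | hx0
    · simp
    -- Rotating by a unimodular scalar makes `f x` equal to its modulus, so the bound on real parts
    -- bounds the norm.
    obtain ⟨a, ha, hfa⟩ := RCLike.exists_norm_eq_mul_self (f x)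
    have hpos : 0 < ‖x‖ := norm_pos_iff.2 hx0
    have h1 := h ((a * ((‖x‖⁻¹ : ℝ) : 𝕜)) • x) (Z.smul_mem _ hx) (by
      rw [norm_smul, norm_mul, ha, one_mul, RCLike.norm_ofReal, abs_of_nonneg (by positivity)]
      exact inv_mul_cancel₀ hpos.ne')
    have h2 : f ((a * ((‖x‖⁻¹ : ℝ) : 𝕜)) • x) = ((‖x‖⁻¹ * ‖f x‖ : ℝ) : 𝕜) := by
      rw [map_smul, smul_eq_mul, mul_right_comm, ← hfa]
      push_cast
      ring
    rw [h2, RCLike.ofReal_re, inv_mul_le_iff₀ hpos] at h1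
    linarith
  · have := hg ⟨x, hx⟩
    simp [this]

/-- A point of `s_ε(K)` is a weak-star cluster point of points of `K` that differ from it by at
least `ε / 8` on a unit vector annihilated by given functionals. -/
theorem exists_unit_vector_of_mem_szlenkDeriv {ε : ℝ} (hε : 0 < ε) {K : Set (WeakDual 𝕜 X)}
    {f : WeakDual 𝕜 X} (hf : f ∈ szlenkDeriv ε K) (F : Finset (StrongDual 𝕜 X))
    {V : Set (WeakDual 𝕜 X)} (hV : V ∈ 𝓝 f) :
    ∃ g ∈ K, g ∈ V ∧ ∃ x : X, ‖x‖ = 1 ∧ (∀ φ ∈ F, φ x = 0) ∧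
      ε / 8 ≤ RCLike.re (g x) - RCLike.re (f x) := by
  by_contra! hcon
  set Z : Submodule 𝕜 X := ⨅ φ : F, φ.1.toLinearMap.ker with hZ
  have hmemZ : ∀ x, x ∈ Z ↔ ∀ φ ∈ F, φ x = 0 := by
    intro x
    simp [hZ, Submodule.mem_iInf]
  set B : Submodule 𝕜 (WeakDual 𝕜 X) :=
    Submodule.span 𝕜 (Set.range fun φ : F => StrongDual.toWeakDual φ.1) with hB
  have : FiniteDimensional 𝕜 B := FiniteDimensional.span_of_finite 𝕜 (Set.finite_range _)
  -- If the claim fails, each `g - f` with `g ∈ K ∩ V` is a functional of norm at most `ε / 8` plus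
  -- an element of the span `B` of `F`.
  have hchoice : ∀ g : WeakDual 𝕜 X, ∃ h : WeakDual 𝕜 X, ‖WeakDual.toStrongDual h‖ ≤ ε / 8 ∧
      (g ∈ K → g ∈ V → g - f - h ∈ B) := by
    intro g
    by_cases hg : g ∈ K ∧ g ∈ V
    · obtain ⟨h, hn, hz⟩ := exists_norm_le_of_re_le
        (WeakDual.toStrongDual g - WeakDual.toStrongDual f) Z (c := ε / 8) (by positivity)
        (fun x hx hx1 => by
          simpa using (hcon g hg.1 hg.2 x hx1 ((hmemZ x).1 hx)).le)
      refine ⟨StrongDual.toWeakDual h, hn, fun _ _ => ?_⟩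
      have hspan := mem_span_of_iInf_ker_le_ker (L := fun φ : F => φ.1.toLinearMap)
        (K := (WeakDual.toStrongDual g - WeakDual.toStrongDual f - h).toLinearMap)
        (fun x hx => hz x hx)
      obtain ⟨c, hc⟩ := (Submodule.mem_span_range_iff_exists_fun 𝕜).1 hspan
      refine (Submodule.mem_span_range_iff_exists_fun 𝕜).2 ⟨c, ?_⟩
      refine DFunLike.ext _ _ fun x => ?_
      have := LinearMap.congr_fun hc x
      simp only [LinearMap.coe_sum, Finset.sum_apply, LinearMap.smul_apply,
        ContinuousLinearMap.coe_coe] at this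
      have h2 : (∑ i, c i • StrongDual.toWeakDual (i : F).1) x = ∑ i, c i • (i : F).1 x := by
        change (∑ i, c i • (i : F).1 : StrongDual 𝕜 X) x = _
        simp
      rw [h2, this]
      rfl
    · exact ⟨0, by simpa using (by positivity : 0 ≤ ε / 8), fun h1 h2 => absurd ⟨h1, h2⟩ hg⟩
  choose h hn hB' using hchoice
  have hne : (𝓝 f ⊓ 𝓟 {g | g ∈ K ∧
      ε / 2 < ‖WeakDual.toStrongDual g - WeakDual.toStrongDual f‖}).NeBot :=
    frequently_mem_iff_neBot.1 (frequently_lt_norm_sub_of_mem_szlenkDeriv hε hf)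
  set U := Ultrafilter.of (𝓝 f ⊓ 𝓟 {g | g ∈ K ∧
      ε / 2 < ‖WeakDual.toStrongDual g - WeakDual.toStrongDual f‖})
  have hU := Ultrafilter.of_le (𝓝 f ⊓ 𝓟 {g | g ∈ K ∧
      ε / 2 < ‖WeakDual.toStrongDual g - WeakDual.toStrongDual f‖})
  have hUf : Tendsto id (U : Filter (WeakDual 𝕜 X)) (𝓝 f) := hU.trans inf_le_left
  have hUfar : ∀ᶠ g in (U : Filter (WeakDual 𝕜 X)), g ∈ K ∧
      ε / 2 < ‖WeakDual.toStrongDual g - WeakDual.toStrongDual f‖ :=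
    le_principal_iff.1 (hU.trans inf_le_right)
  obtain ⟨h', hh'n, hh'⟩ := (WeakDual.isCompact_closedBall (0 : StrongDual 𝕜 X)
    (ε / 8)).ultrafilter_le_nhds (U.map h)
    (le_principal_iff.2 (mem_map.2 (Eventually.of_forall fun g => by simpa using hn g)))
  replace hh' : Tendsto h U (𝓝 h') := hh'
  -- Along `g → f` the parts in `B` converge weak-star to `-h'`, hence in norm because `B` is
  -- finite-dimensional. So `‖g - f‖` is eventually at most `ε / 4 + ε / 8`, although it exceeds `ε
  -- / 2`.
  have hlim : Tendsto (fun g => g - f - h g) (U : Filter (WeakDual 𝕜 X)) (𝓝 (-h')) := by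
    simpa using (hUf.sub_const f).sub hh'
  have hmem : ∀ᶠ g in (U : Filter (WeakDual 𝕜 X)), g - f - h g ∈ B := by
    filter_upwards [hUfar, hUf.eventually hV] with g hg hgV using hB' g hg.1 hgV
  have hlimB : -h' ∈ B := B.closed_of_finiteDimensional.mem_of_tendsto hlim hmem
  set J : B →ₗ[𝕜] StrongDual 𝕜 X := WeakDual.toStrongDual.toLinearMap ∘ₗ B.subtype
  have hJ : Continuous J := 
    LinearMap.continuous_of_finiteDimensional (E := B) (F' := StrongDual 𝕜 X) J
  have hev : ∀ᶠ b in 𝓝[B] (-h'), ‖WeakDual.toStrongDual b‖ < ε / 4 := by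
    rw [nhdsWithin_eq_map_subtype_coe hlimB]
    refine hJ.norm.tendsto ⟨-h', hlimB⟩ (Iio_mem_nhds ?_)
    have h1 : ‖WeakDual.toStrongDual h'‖ ≤ ε / 8 := by simpa using hh'n
    have h2 : J ⟨-h', hlimB⟩ = -WeakDual.toStrongDual h' := map_neg WeakDual.toStrongDual h'
    rw [h2, norm_neg]
    linarith
  have hfin := (tendsto_nhdsWithin_iff.2 ⟨hlim, hmem⟩).eventually hev
  obtain ⟨g, hg, hg'⟩ := (hfin.and hUfar).exists
  have : ‖WeakDual.toStrongDual g - WeakDual.toStrongDual f‖ ≤ ε / 4 + ε / 8 := by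
    refine (norm_le_norm_sub_add _ (WeakDual.toStrongDual (h g))).trans ?_
    exact add_le_add hg.le (hn g)
  linarith [hg'.2]

/-- A weak neighbourhood of zero contains a finite-codimensional subspace, so exact annihilation
suffices to get weakly null nets. -/
theorem exists_finset_of_mem_nhds_weakSpace {W : Set (WeakSpace 𝕜 X)} (hW : W ∈ 𝓝 0) :
    ∃ F : Finset (StrongDual 𝕜 X), ∀ x : X, (∀ φ ∈ F, φ x = 0) → toWeakSpace 𝕜 X x ∈ W := by
  obtain ⟨S, hS, hSW⟩ := (topDualPairing 𝕜 X).flip.hasBasis_weakBilin.mem_iff.1 hW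
  obtain ⟨F, r, hr, rfl⟩ := (SeminormFamily.basisSets_iff _).1 hS
  refine ⟨F, fun x hx => hSW ?_⟩
  refine (Seminorm.mem_ball_zero _).2 ?_
  refine Seminorm.finset_sup_apply_lt hr fun φ hφ => ?_
  change ‖φ x‖ < r
  rwa [hx φ hφ, norm_zero]

variable (𝕜 X) in
/-- The weak neighbourhoods of `0`, directed by reverse inclusion. -/
abbrev WeakNhdsZero : Type u := {W : Set (WeakSpace 𝕜 X) // W ∈ 𝓝 0}ᵒᵈ

instance : IsDirectedOrder (WeakNhdsZero 𝕜 X) where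
  directed V W := ⟨OrderDual.toDual ⟨(OrderDual.ofDual V).1 ∩ (OrderDual.ofDual W).1,
    inter_mem (OrderDual.ofDual V).2 (OrderDual.ofDual W).2⟩,
    Set.inter_subset_left, Set.inter_subset_right⟩

instance : Nonempty (WeakNhdsZero 𝕜 X) := ⟨OrderDual.toDual ⟨Set.univ, univ_mem⟩⟩

theorem tendsto_weakSpace_of_mem {x : WeakNhdsZero 𝕜 X → X}
    (hx : ∀ W, toWeakSpace 𝕜 X (x W) ∈ (OrderDual.ofDual W).1) :
    Tendsto (fun W => toWeakSpace 𝕜 X (x W)) atTop (𝓝 0) := by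
  intro V hV
  refine mem_map.2 ?_
  filter_upwards [eventually_ge_atTop (OrderDual.toDual ⟨V, hV⟩ : WeakNhdsZero 𝕜 X)] with W hW
  exact hW (hx W)

theorem branchSum_congr {E D : Type*} [NormedAddCommGroup E] {n : ℕ} {x y : List D → E}
    (h : ∀ t, t ≠ [] → x t = y t) {t : List D} (ht : t.length = n) :
    branchSum n x t = branchSum n y t := by
  refine Finset.sum_congr rfl fun i _ => h _ ?_
  have := i.2
  rw [← List.length_pos_iff, List.length_take]
  omega

/-- Points of iterated derivations yield weakly null trees of unit vectors with large sums along
all branches. -/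
theorem exists_tree_of_mem_foldr_szlenkDeriv {K : Set (WeakDual 𝕜 X)} (l : List ℝ) :
    (∀ ε ∈ l, 0 < ε) → ∀ f ∈ l.foldr szlenkDeriv K, ∀ (z : X) (η : ℝ), 0 < η →
    ∃ x : List (WeakNhdsZero 𝕜 X) → X,
      (∀ t, 1 ≤ t.length → t.length ≤ l.length → ‖x t‖ = 1) ∧
      IsWeaklyNullTree 𝕜 l.length x ∧
      ∀ t, t.length = l.length → ∃ g ∈ K,
        RCLike.re (f z) + l.sum / 8 - η ≤ RCLike.re (g (z + branchSum l.length x t)) := by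
  induction l with
  | nil =>
    intro _ f hf z η hη
    refine ⟨fun _ => 0, fun t h1 h2 => ?_, fun t ht => absurd ht (by simp), fun t _ =>
      ⟨f, hf, ?_⟩⟩
    · simp at h2
      simp [h2] at h1
    · simp [branchSum_zero, hη.le]
  | cons ε l ih =>
    intro hl f hf z η hη
    have hε : 0 < ε := hl ε (by simp)
    have hV : {g : WeakDual 𝕜 X | RCLike.re (f z) - η / 2 < RCLike.re (g z)} ∈ 𝓝 f :=
      (isOpen_lt continuous_const (RCLike.continuous_re.comp (WeakDual.eval_continuous z))).mem_nhds
        (by simpa using hη)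
    have hstep : ∀ W : WeakNhdsZero 𝕜 X, ∃ (v : X) (y : List (WeakNhdsZero 𝕜 X) → X),
        ‖v‖ = 1 ∧ toWeakSpace 𝕜 X v ∈ (OrderDual.ofDual W).1 ∧
        (∀ t, 1 ≤ t.length → t.length ≤ l.length → ‖y t‖ = 1) ∧
        IsWeaklyNullTree 𝕜 l.length y ∧
        ∀ t, t.length = l.length → ∃ g ∈ K, RCLike.re (f z) + (ε :: l).sum / 8 - η ≤
          RCLike.re (g (z + (v + branchSum l.length y t))) := by
      classical
      intro W
      obtain ⟨F, hF⟩ := exists_finset_of_mem_nhds_weakSpace (OrderDual.ofDual W).2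
      -- Including `f` itself among the annihilated functionals gives `f v = 0`, so the gain `ε / 8`
      -- falls entirely on `g v`. Half of `η` pays for `g z` in place of `f z`, the other half for
      -- the remaining levels.
      obtain ⟨g, hgK, hgV, v, hv1, hvF, hv⟩ := exists_unit_vector_of_mem_szlenkDeriv hε hf
        (insert (WeakDual.toStrongDual f) F) hV
      obtain ⟨y, hy1, hy2, hy3⟩ := ih (fun ε hε => hl ε (by simp [hε])) g hgK (z + v) (η / 2)
        (by positivity)
      refine ⟨v, y, hv1, hF v fun φ hφ => hvF φ (by simp [hφ]), hy1, hy2, fun t ht => ?_⟩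
      obtain ⟨g', hg', hle⟩ := hy3 t ht
      refine ⟨g', hg', ?_⟩
      rw [← add_assoc]
      refine le_trans ?_ hle
      have hfv : f v = 0 := hvF (WeakDual.toStrongDual f) (by simp)
      have hgz : RCLike.re (f z) - η / 2 < RCLike.re (g z) := hgV
      rw [hfv, map_zero] at hv
      rw [map_add, map_add, List.sum_cons]
      linarith
    choose v y hv1 hvW hy1 hy2 hy3 using hstep
    refine ⟨fun t => match t with
      | [] => 0
      | [W] => v W
      | W :: W' :: t => y W (W' :: t), ?_, ?_, ?_⟩
    · rintro (_ | ⟨W, _ | ⟨W', t⟩⟩) h1 h2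
      · simp at h1
      · exact hv1 W
      · exact hy1 W (W' :: t) (by simp) (by simpa using h2)
    · rintro (_ | ⟨W, t⟩) ht φ
      · exact tendsto_toWeakSpace_zero_iff.1 (tendsto_weakSpace_of_mem hvW) φ
      · have := hy2 W t (by simpa using ht) φ
        refine this.congr fun d => ?_
        cases t <;> rfl
    · rintro (_ | ⟨W, t⟩) ht
      · simp at ht
      · simp only [List.length_cons, add_left_inj] at ht
        obtain ⟨g, hg, hle⟩ := hy3 W t ht
        refine ⟨g, hg, hle.trans_eq ?_⟩
        rw [List.length_cons, branchSum_cons]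
        congr 4
        refine branchSum_congr (fun t ht => ?_) ht
        cases t
        · exact absurd rfl ht
        · rfl

end TreeOfDerivation

/-! ### Ultrafilters on branches and cofinal subtrees -/

section BranchUltrafilter

variable {D : Type*}

/-- The iterated ultrafilter limit of order `n`, as an ultrafilter on sequences of length `n`. -/
def branchUltrafilter (U : Ultrafilter D) : ℕ → Ultrafilter (List D)
  | 0 => pure []
  | n + 1 => U.bind fun d => (branchUltrafilter U n).map (List.cons d)

theorem eventually_branchUltrafilter_zero {U : Ultrafilter D} {p : List D → Prop} :
    (∀ᶠ t in (branchUltrafilter U 0 : Filter (List D)), p t) ↔ p [] := Iff.rfl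

theorem eventually_branchUltrafilter_succ {U : Ultrafilter D} {n : ℕ} {p : List D → Prop} :
    (∀ᶠ t in (branchUltrafilter U (n + 1) : Filter (List D)), p t) ↔
      ∀ᶠ d in (U : Filter D), ∀ᶠ t in (branchUltrafilter U n : Filter (List D)), p (d :: t) :=
  Iff.rfl

theorem eventually_length_eq (U : Ultrafilter D) (n : ℕ) :
    ∀ᶠ t in (branchUltrafilter U n : Filter (List D)), t.length = n := by
  induction n with
  | zero => exact eventually_branchUltrafilter_zero.2 rfl
  | succ n ih =>
    exact eventually_branchUltrafilter_succ.2 (Eventually.of_forall fun d =>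
      ih.mono fun t ht => by simp [ht])

/-- Any set in the iterated ultrafilter contains all branches of a cofinal subtree. -/
theorem exists_subtree [Preorder D] {U : Ultrafilter D} (hU : (U : Filter D) ≤ atTop) (n : ℕ) :
    ∀ p : List D → Prop, (∀ᶠ t in (branchUltrafilter U n : Filter (List D)), p t) →
    ∃ φ : List D → List D, (∀ t, (φ t).length = t.length) ∧
      (∀ t k, φ (t.take k) = (φ t).take k) ∧
      (∀ t, ∃ u : D → D, (∀ d, d ≤ u d) ∧ ∀ d, φ (t ++ [d]) = φ t ++ [u d]) ∧
      ∀ t, t.length = n → p (φ t) := by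
  induction n with
  | zero =>
    intro p hp
    refine ⟨id, fun _ => rfl, fun _ _ => rfl, fun t => ⟨id, fun _ => le_rfl, fun _ => rfl⟩, ?_⟩
    intro t ht
    rw [List.length_eq_zero_iff] at ht
    exact ht ▸ eventually_branchUltrafilter_zero.1 hp
  | succ n ih =>
    intro p hp
    rw [eventually_branchUltrafilter_succ] at hp
    -- Choosing a label beyond `d` keeps the relabelled nets convergent, so that pruning preserves
    -- weak nullity.
    have hex : ∀ d : D, ∃ u, d ≤ u ∧
        ∀ᶠ t in (branchUltrafilter U n : Filter (List D)), p (u :: t) :=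
      fun d => (((eventually_ge_atTop d).filter_mono hU).and hp).exists
    choose u hdu hu using hex
    choose φ h1 h2 h3 h4 using fun d => ih _ (hu d)
    refine ⟨fun t => match t with
      | [] => []
      | d :: t => u d :: φ d t, ?_, ?_, ?_, ?_⟩
    · rintro (_ | ⟨d, t⟩)
      · rfl
      · simp [h1]
    · rintro (_ | ⟨d, t⟩) (_ | k)
      · rfl
      · rfl
      · rfl
      · simp [h2]
    · rintro (_ | ⟨d, t⟩)
      · refine ⟨u, hdu, fun d => ?_⟩
        have := h1 d []
        rw [List.length_nil, List.length_eq_zero_iff] at this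
        simp [this]
      · obtain ⟨w, hw, hw'⟩ := h3 d t
        exact ⟨w, hw, fun d' => by simp [hw']⟩
    · rintro (_ | ⟨d, t⟩) ht
      · simp at ht
      · exact h4 d t (by simpa using ht)

end BranchUltrafilter

/-! ### Automatic lower estimates along most branches -/

section LowerEstimate

variable {𝕜 : Type*} [RCLike 𝕜] {E : Type*} [NormedAddCommGroup E] [NormedSpace 𝕜 E]
variable {D : Type*} [Preorder D] {U : Ultrafilter D}

theorem eventually_norm_apply_branchSum_lt (hU : (U : Filter D) ≤ atTop) (f : StrongDual 𝕜 E)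
    (n : ℕ) : ∀ (x : List D → E), IsWeaklyNullTree 𝕜 n x → ∀ δ > 0,
    ∀ᶠ t in (branchUltrafilter U n : Filter (List D)), ‖f (branchSum n x t)‖ < δ := by
  induction n with
  | zero =>
    intro x _ δ hδ
    simpa [eventually_branchUltrafilter_zero, branchSum_zero] using hδ
  | succ n ih =>
    intro x hx δ hδ
    rw [eventually_branchUltrafilter_succ]
    have h0 := ((hx.root f).norm.eventually
      (eventually_lt_nhds (b := δ / 2) (by simpa using hδ))).filter_mono hU
    filter_upwards [h0] with d hd
    filter_upwards [ih _ (hx.cons d) (δ / 2) (by positivity)] with t ht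
    rw [branchSum_cons, map_add]
    have hd' : ‖f (x [d])‖ < δ / 2 := hd
    linarith [norm_add_le (f (x [d])) (f (branchSum n (fun t => x (d :: t)) t))]

/-- Weak lower semicontinuity of the norm: a functional norming `v` is almost zero on most branch
sums. -/
theorem eventually_lt_norm_add_branchSum (hU : (U : Filter D) ≤ atTop) (n : ℕ) {x : List D → E}
    (hx : IsWeaklyNullTree 𝕜 n x) (v : E) {r : ℝ} (hr : r < ‖v‖) :
    ∀ᶠ t in (branchUltrafilter U n : Filter (List D)), r < ‖v + branchSum n x t‖ := by
  obtain ⟨f, hf1, hfv⟩ := exists_dual_vector'' 𝕜 v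
  filter_upwards [eventually_norm_apply_branchSum_lt hU f n x hx (‖v‖ - r) (by linarith)] with t ht
  have h1 : ‖f v‖ = ‖v‖ := by rw [hfv]; simp
  have h2 : ‖f v‖ - ‖f (branchSum n x t)‖ ≤ ‖f (v + branchSum n x t)‖ := by
    rw [map_add]
    exact norm_sub_le_norm_add _ _
  have h3 : ‖f (v + branchSum n x t)‖ ≤ 1 * ‖v + branchSum n x t‖ := f.le_of_opNorm_le hf1 _
  linarith

/-- If all vectors on level `j` of a weakly null tree have norm at least `ρ`, then the sums
have norm at least about `ρ / 2` along most branches. -/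
theorem eventually_lt_norm_add_branchSum_of_level (hU : (U : Filter D) ≤ atTop) {ρ r : ℝ}
    (hr : r < ρ / 2) (n : ℕ) : ∀ (j : ℕ) (x : List D → E), j < n → IsWeaklyNullTree 𝕜 n x →
    (∀ t, t.length = j + 1 → ρ ≤ ‖x t‖) → ∀ v : E,
    ∀ᶠ t in (branchUltrafilter U n : Filter (List D)), r < ‖v + branchSum n x t‖ := by
  induction n with
  | zero => intro j _ hj; omega
  | succ n ih =>
    intro j x hj hx hρ v
    rw [eventually_branchUltrafilter_succ]
    simp only [branchSum_cons, ← add_assoc]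
    rcases j with _ | j
    -- If `‖v‖ > r`, adding a weakly null vector keeps this; otherwise `‖v + x [d]‖ ≥ ρ - r > r`.
    -- This dichotomy is the source of the factor `1 / 2`.
    · have hev : ∀ᶠ d in (U : Filter D), r < ‖v + x [d]‖ := by
        rcases lt_or_ge r ‖v‖ with hv | hv
        · have h := eventually_lt_norm_add_branchSum hU 1 (x := x)
            (fun t ht => hx t (by omega)) v hv
          rw [eventually_branchUltrafilter_succ] at h
          simpa [eventually_branchUltrafilter_zero, branchSum] using h
        · refine Eventually.of_forall fun d => ?_
          have h1 := hρ [d] (by simp)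
          have h2 : ‖x [d]‖ ≤ ‖v + x [d]‖ + ‖v‖ := by
            have := norm_sub_le (v + x [d]) v
            rwa [add_sub_cancel_left] at this
          linarith
      filter_upwards [hev] with d hd
      exact eventually_lt_norm_add_branchSum hU n (hx.cons d) _ hd
    · exact Eventually.of_forall fun d => ih j _ (by omega) (hx.cons d)
        (fun t ht => hρ (d :: t) (by simpa using ht)) _

end LowerEstimate

/-! ### Trees with coefficients -/

section Scale

variable {𝕜 : Type*} [RCLike 𝕜] {E : Type*} [NormedAddCommGroup E] [NormedSpace 𝕜 E]
variable {D : Type*}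

/-- The collection obtained by multiplying the vectors on the `i`-th level by the `i`-th
coordinate of `a`. -/
def scaleTree {n : ℕ} (a : Fin n → 𝕜) (x : List D → E) (t : List D) : E :=
  if h : t.length - 1 < n then a ⟨t.length - 1, h⟩ • x t else 0

theorem branchSum_scaleTree {n : ℕ} (a : Fin n → 𝕜) (x : List D → E) {t : List D}
    (ht : t.length = n) :
    branchSum n (scaleTree a x) t = ∑ i : Fin n, a i • x (t.take (i + 1)) := by
  refine Finset.sum_congr rfl fun i _ => ?_
  have hi : (t.take (i + 1)).length - 1 = i := by
    have := i.2
    rw [List.length_take]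
    omega
  simp only [scaleTree, hi, i.2, dif_pos, Fin.eta]

theorem IsWeaklyNullTree.scaleTree [Preorder D] {n : ℕ} {x : List D → E}
    (hx : IsWeaklyNullTree 𝕜 n x) (a : Fin n → 𝕜) : IsWeaklyNullTree 𝕜 n (scaleTree a x) := by
  intro t ht f
  have := (hx t ht f).const_mul (a ⟨t.length, ht⟩)
  rw [mul_zero] at this
  refine this.congr fun d => ?_
  simp [SummableSzlenk.scaleTree, ht]

/-- The norm along most branches is almost bounded below by half of the maximum norm. -/
theorem eventually_lt_norm_sum_smul [Preorder D] {U : Ultrafilter D}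
    (hU : (U : Filter D) ≤ atTop) {n : ℕ} {x : List D → E} (hx : IsWeaklyNullTree 𝕜 n x)
    (hx1 : ∀ t, 1 ≤ t.length → t.length ≤ n → ‖x t‖ = 1) (a : Fin n → 𝕜) {r : ℝ}
    (hn : 1 ≤ n) (hr : r < ‖a‖ / 2) :
    ∀ᶠ t in (branchUltrafilter U n : Filter (List D)),
      r < ‖∑ i : Fin n, a i • x (t.take (i + 1))‖ := by
  have : Nonempty (Fin n) := ⟨⟨0, hn⟩⟩
  obtain ⟨j, hj⟩ : ∃ j, ‖a‖ = ‖a j‖ := by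
    obtain ⟨j, -, hj⟩ := Finset.exists_mem_eq_sup' Finset.univ_nonempty fun j => ‖a j‖₊
    refine ⟨j, ?_⟩
    rw [Pi.norm_def, ← coe_nnnorm, ← hj, Finset.sup'_eq_sup]
  have h := eventually_lt_norm_add_branchSum_of_level hU (r := r) (ρ := ‖a‖) hr n j
    (scaleTree a x) j.2 (hx.scaleTree a) (fun t ht => by
      have h1 := hx1 t (by omega) (by have := j.2; omega)
      simp [scaleTree, ht, norm_smul, h1, hj]) 0
  filter_upwards [h, eventually_length_eq U n] with t ht htn
  rwa [zero_add, branchSum_scaleTree a x htn] at ht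

theorem norm_sum_smul_le {n : ℕ} {x : List D → E}
    (hx1 : ∀ t, 1 ≤ t.length → t.length ≤ n → ‖x t‖ = 1) (a : Fin n → 𝕜) {t : List D}
    (ht : t.length = n) : ‖∑ i : Fin n, a i • x (t.take (i + 1))‖ ≤ n * ‖a‖ := by
  refine (norm_sum_le_of_le _ (n := fun _ => ‖a‖) fun i _ => ?_).trans_eq (by simp)
  rw [norm_smul, hx1, mul_one]
  · exact norm_le_pi_norm a i
  · have := i.2
    rw [List.length_take]
    omega
  · exact List.length_take_le _ _ |>.trans (by omega)

end Scale

/-! ### Norms of the asymptotic structure as limits along branches -/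

section Stabilisation

variable {𝕜 : Type v} [RCLike 𝕜] {E : Type u} [NormedAddCommGroup E] [NormedSpace 𝕜 E]
variable {D : Type u}

/-- The limit of the norms along the branches of a normalised collection. -/
theorem exists_limit_seminorm (U : Ultrafilter D) {n : ℕ} {x : List D → E}
    (hx1 : ∀ t, 1 ≤ t.length → t.length ≤ n → ‖x t‖ = 1) :
    ∃ N : Seminorm 𝕜 (Fin n → 𝕜), ∀ a, Tendsto
      (fun t : List D => ‖∑ i : Fin n, a i • x (t.take (i + 1))‖) (branchUltrafilter U n)
      (𝓝 (N a)) := by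
  have hex : ∀ a : Fin n → 𝕜, ∃ L : ℝ, Tendsto
      (fun t : List D => ‖∑ i : Fin n, a i • x (t.take (i + 1))‖) (branchUltrafilter U n)
      (𝓝 L) := by
    intro a
    obtain ⟨L, -, hL⟩ := (isCompact_Icc (a := (0 : ℝ)) (b := n * ‖a‖)).ultrafilter_le_nhds
      ((branchUltrafilter U n).map
        fun t : List D => ‖∑ i : Fin n, a i • x (t.take (i + 1))‖)
      (le_principal_iff.2 (mem_map.2 ((eventually_length_eq U n).mono fun t ht =>
        ⟨norm_nonneg _, norm_sum_smul_le hx1 a ht⟩)))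
    exact ⟨L, hL⟩
  choose N hN using hex
  refine ⟨Seminorm.of N (fun a b => ?_) (fun c a => ?_), hN⟩
  · refine le_of_tendsto_of_tendsto' (hN (a + b)) ((hN a).add (hN b)) fun t => ?_
    simp only [Pi.add_apply, add_smul, Finset.sum_add_distrib]
    exact norm_add_le _ _
  · refine tendsto_nhds_unique (hN (c • a)) (((hN a).const_mul ‖c‖).congr fun t => ?_)
    simp only [Pi.smul_apply, smul_assoc, ← Finset.smul_sum, norm_smul]

/-- Pointwise convergence is uniform on the compact sphere: on a finite net it holds eventually, and
all the seminorms involved are bounded by `n` times the maximum norm. -/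
theorem eventually_forall_sphere_abs_sub_le {U : Ultrafilter D} {n : ℕ} {x : List D → E}
    (hx1 : ∀ t, 1 ≤ t.length → t.length ≤ n → ‖x t‖ = 1) {N : Seminorm 𝕜 (Fin n → 𝕜)}
    (hN : ∀ a, Tendsto (fun t : List D => ‖∑ i : Fin n, a i • x (t.take (i + 1))‖)
      (branchUltrafilter U n) (𝓝 (N a))) {δ : ℝ} (hδ : 0 < δ) :
    ∀ᶠ t in (branchUltrafilter U n : Filter (List D)), ∀ a : Fin n → 𝕜, ‖a‖ = 1 →
      |‖∑ i : Fin n, a i • x (t.take (i + 1))‖ - N a| ≤ δ := by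
  have hNle : ∀ a, N a ≤ n * ‖a‖ := fun a => le_of_tendsto (hN a)
    ((eventually_length_eq U n).mono fun t ht => norm_sum_smul_le hx1 a ht)
  obtain ⟨A, -, hA, hcov⟩ := (isCompact_sphere (0 : Fin n → 𝕜) 1).finite_cover_balls
    (e := δ / (3 * (n + 1))) (by positivity)
  have hev : ∀ᶠ t in (branchUltrafilter U n : Filter (List D)), ∀ a ∈ A,
      |‖∑ i : Fin n, a i • x (t.take (i + 1))‖ - N a| ≤ δ / 3 := by
    refine (eventually_all_finite hA).2 fun a _ => ?_
    have := (hN a).eventually (Metric.closedBall_mem_nhds (N a) (by positivity : 0 < δ / 3))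
    exact this
  filter_upwards [hev, eventually_length_eq U n] with t ht htn a ha
  obtain ⟨a', ha', haa'⟩ := Set.mem_iUnion₂.1 (hcov (by simpa using ha))
  have hd : n * ‖a - a'‖ ≤ δ / 3 := by
    rw [Metric.mem_ball, dist_eq_norm, lt_div_iff₀ (by positivity)] at haa'
    nlinarith [norm_nonneg (a - a')]
  have h1 : |N a - N a'| ≤ δ / 3 := (abs_sub_map_le_sub N a a').trans ((hNle _).trans hd)
  have h2 : |‖∑ i : Fin n, a i • x (t.take (i + 1))‖ -
      ‖∑ i : Fin n, a' i • x (t.take (i + 1))‖| ≤ δ / 3 := by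
    refine (abs_norm_sub_norm_le _ _).trans (le_trans ?_ hd)
    rw [← Finset.sum_sub_distrib]
    simpa only [Pi.sub_apply, sub_smul] using norm_sum_smul_le hx1 (a - a') htn
  have h3 := ht a' ha'
  rw [abs_le] at *
  constructor <;> linarith [h1.1, h1.2, h2.1, h2.2, h3.1, h3.2]

/-- Every normalised weakly null collection generates a norm in the asymptotic structure. -/
theorem exists_mem_asymptoticStructure [Preorder D] [IsDirectedOrder D] [Nonempty D] {n : ℕ}
    (hn : 1 ≤ n) {x : List D → E}
    (hx1 : ∀ t, 1 ≤ t.length → t.length ≤ n → ‖x t‖ = 1) (hx : IsWeaklyNullTree 𝕜 n x) :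
    ∃ N : Seminorm 𝕜 (Fin n → 𝕜), InAsymptoticStructure 𝕜 E n N ∧
      ∀ (a : Fin n → 𝕜) (c : ℝ),
        (∀ t : List D, t.length = n → c ≤ ‖∑ i : Fin n, a i • x (t.take (i + 1))‖) →
        c ≤ N a := by
  set U : Ultrafilter D := Ultrafilter.of atTop
  have hU : (U : Filter D) ≤ atTop := Ultrafilter.of_le _
  obtain ⟨N, hN⟩ := exists_limit_seminorm (𝕜 := 𝕜) U hx1
  have hlow : ∀ a, ‖a‖ / 2 ≤ N a := fun a => le_of_forall_lt_imp_le_of_dense fun r hr =>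
    ge_of_tendsto (hN a) ((eventually_lt_norm_sum_smul hU hx hx1 a hn hr).mono fun _ h => h.le)
  refine ⟨N, ⟨fun a ha => ?_, fun b hb => ?_⟩, fun a c h =>
    ge_of_tendsto (hN a) ((eventually_length_eq U n).mono h)⟩
  · have := hlow a
    rw [ha] at this
    exact norm_le_zero_iff.1 (by linarith)
  · have hb0 : 0 < b := by linarith
    -- Since `N ≥ 1 / 2` on the sphere, an additive error `δ` with `bδ = (b - 1) / 2` becomes a
    -- multiplicative error `b`.
    have hev := eventually_forall_sphere_abs_sub_le hx1 hN (δ := (b - 1) / (2 * b))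
      (div_pos (by linarith) (by linarith))
    obtain ⟨φ, h1, h2, h3, h4⟩ := exists_subtree hU n _ hev
    refine ⟨D, inferInstance, inferInstance, inferInstance, fun t => x (φ t),
      fun t ht1 htn => hx1 _ (by rwa [h1]) (by rwa [h1]), weaklyNullTree_iff.2 fun t ht f => ?_,
      fun a ha t ht => ?_⟩
    · obtain ⟨w, hw, hw'⟩ := h3 t
      simp only [hw']
      exact (hx (φ t) (by rwa [h1]) f).comp (tendsto_atTop_mono hw tendsto_id)
    · simp only [h2]
      have h := h4 t ht a ha
      have hl := hlow a
      rw [ha] at hl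
      have hδ : b * ((b - 1) / (2 * b)) = (b - 1) / 2 := by field_simp
      have hδ' : (b - 1) / (2 * b) ≤ (b - 1) / 2 := by
        rw [div_le_div_iff₀ (by positivity) (by positivity)]
        nlinarith
      rw [abs_le] at h
      constructor
      · rw [inv_mul_le_iff₀ hb0]
        nlinarith [h.2]
      · nlinarith [mul_le_mul_of_nonneg_left h.1 hb0.le]

end Stabilisation

/-! ### The tree characterisation for operators -/

section Operators

variable {𝕜 : Type*} [RCLike 𝕜]
variable {X Y : Type*} [NormedAddCommGroup X] [NormedSpace 𝕜 X]
  [NormedAddCommGroup Y] [NormedSpace 𝕜 Y]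

theorem mem_adjointBall {A : X →L[𝕜] Y} {f : WeakDual 𝕜 X} :
    f ∈ adjointBall A ↔ ∃ y : StrongDual 𝕜 Y, ‖y‖ ≤ 1 ∧
      StrongDual.toWeakDual (y.comp A) = f := by
  simp only [adjointBall, Set.mem_image, mem_closedBall_zero_iff]
  rfl

theorem isCompact_adjointBall (A : X →L[𝕜] Y) : IsCompact (adjointBall A) := by
  have hcont : Continuous fun y : WeakDual 𝕜 Y =>
      StrongDual.toWeakDual ((WeakDual.toStrongDual y).comp A) :=
    WeakDual.continuous_of_continuous_eval fun x => WeakDual.eval_continuous (A x)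
  convert (WeakDual.isCompact_closedBall (0 : StrongDual 𝕜 Y) 1).image hcont using 1
  ext f
  rw [mem_adjointBall]
  constructor
  · rintro ⟨y, hy, rfl⟩
    exact ⟨StrongDual.toWeakDual y, by simpa using hy, rfl⟩
  · rintro ⟨y, hy, rfl⟩
    exact ⟨WeakDual.toStrongDual y, by simpa using hy, rfl⟩

theorem norm_le_of_mem_adjointBall {A : X →L[𝕜] Y} {f : WeakDual 𝕜 X} (hf : f ∈ adjointBall A) :
    ‖WeakDual.toStrongDual f‖ ≤ ‖A‖ := by
  obtain ⟨y, hy, rfl⟩ := mem_adjointBall.1 hf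
  exact (ContinuousLinearMap.opNorm_comp_le y A).trans
    (mul_le_of_le_one_left (norm_nonneg A) hy)

theorem re_apply_le_of_mem_adjointBall {A : X →L[𝕜] Y} {f : WeakDual 𝕜 X}
    (hf : f ∈ adjointBall A) (x : X) : RCLike.re (f x) ≤ ‖A x‖ := by
  obtain ⟨y, hy, rfl⟩ := mem_adjointBall.1 hf
  refine (RCLike.re_le_norm _).trans ?_
  simpa using y.le_of_opNorm_le hy (A x)

theorem norm_le_of_forall_mem_adjointBall {A : X →L[𝕜] Y} {x : X} {C : ℝ}
    (h : ∀ f ∈ adjointBall A, RCLike.re (f x) ≤ C) : ‖A x‖ ≤ C := by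
  obtain ⟨y, hy, hyx⟩ := exists_dual_vector'' 𝕜 (A x)
  have h1 : RCLike.re (y (A x)) ≤ C := h _ (mem_adjointBall.2 ⟨y, hy, rfl⟩)
  rwa [hyx, RCLike.ofReal_re] at h1

/-- An operator with summable Szlenk index maps the sums of weakly null trees in the unit ball to
bounded vectors along some branch. -/
theorem OpHasSummableSzlenk.exists_tree_bound {A : X →L[𝕜] Y} (hA : OpHasSummableSzlenk A) :
    ∃ C : ℝ, ∀ (D : Type w) [Preorder D] [IsDirectedOrder D] [Nonempty D] (n : ℕ)
      (x : List D → X), (∀ t, 1 ≤ t.length → t.length ≤ n → ‖x t‖ ≤ 1) →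
      IsWeaklyNullTree 𝕜 n x → ∃ t, t.length = n ∧ ‖A (branchSum n x t)‖ ≤ C := by
  obtain ⟨M, -, hM⟩ := hA
  refine ⟨1 * (M + M) + 2 * 1 + 1, fun D _ _ _ n x hx1 hx => ?_⟩
  obtain ⟨t, ht, h⟩ := exists_branch_re_le (isCompact_adjointBall A) (isCompact_adjointBall A)
    hM hM (T := fun f _ => WeakDual.toStrongDual f) zero_le_one
    (fun f _ f' _ g _ g' _ => by
      rw [one_mul]
      exact le_add_of_nonneg_right (norm_nonneg _))
    (fun e => ((WeakDual.eval_continuous e).comp continuous_fst).continuousOn) hx1 hx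
  exact ⟨t, ht, norm_le_of_forall_mem_adjointBall fun f hf => h f hf f hf⟩

/-- Trees indexed by weak neighbourhoods of zero suffice, as derivations produce such trees. The
constant inverts `sum / 8 - 1 ≤ C`. -/
theorem opHasSummableSzlenk_of_tree_bound {A : X →L[𝕜] Y} (C : ℝ)
    (h : ∀ (n : ℕ) (x : List (WeakNhdsZero 𝕜 X) → X),
      (∀ t, 1 ≤ t.length → t.length ≤ n → ‖x t‖ ≤ 1) → IsWeaklyNullTree 𝕜 n x →
      ∃ t, t.length = n ∧ ‖A (branchSum n x t)‖ ≤ C) : OpHasSummableSzlenk A := by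
  refine ⟨8 * (|C| + 1), by positivity, fun l hl => ?_⟩
  rw [← foldr_szlenkDeriv_filter_pos] at hl
  obtain ⟨f, hf⟩ := hl
  obtain ⟨x, hx1, hx, hx2⟩ := exists_tree_of_mem_foldr_szlenkDeriv (l.filter (0 < ·))
    (fun ε hε => by simpa using (List.mem_filter.1 hε).2) f hf 0 1 one_pos
  obtain ⟨t, ht, htC⟩ := h _ x (fun t h1 h2 => (hx1 t h1 h2).le) hx
  obtain ⟨g, hg, hle⟩ := hx2 t ht
  rw [zero_add, map_zero, map_zero, zero_add] at hle
  have hre := re_apply_le_of_mem_adjointBall hg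
    (branchSum (l.filter (0 < ·)).length x t)
  linarith [sum_le_sum_filter_pos l, le_abs_self C]

theorem branchSum_map {D : Type*} (J : X →L[𝕜] Y) (n : ℕ) (x : List D → X) (t : List D) :
    branchSum n (fun t => J (x t)) t = J (branchSum n x t) := by
  simp [branchSum]

theorem IsWeaklyNullTree.map {D : Type*} [Preorder D] {n : ℕ} {x : List D → X}
    (hx : IsWeaklyNullTree 𝕜 n x) (J : X →L[𝕜] Y) : IsWeaklyNullTree 𝕜 n fun t => J (x t) :=
  fun t ht f => hx t ht (f.comp J)

/-- Summability of the Szlenk index passes to operators that are dominated in norm. -/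
theorem OpHasSummableSzlenk.of_norm_le {E F : Type*} [NormedAddCommGroup E] [NormedSpace 𝕜 E]
    [NormedAddCommGroup F] [NormedSpace 𝕜 F] {B : E →L[𝕜] F} (hB : OpHasSummableSzlenk B)
    {A : X →L[𝕜] Y} (J : X →L[𝕜] E) {c : ℝ} (hc : 0 ≤ c) (h : ∀ x, ‖A x‖ ≤ c * ‖B (J x)‖) :
    OpHasSummableSzlenk A := by
  obtain ⟨C, hC⟩ := hB.exists_tree_bound
  refine opHasSummableSzlenk_of_tree_bound (c * ((‖J‖ + 1) * C)) fun n x hx1 hx => ?_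
  have hpos : 0 < ‖J‖ + 1 := by positivity
  -- Rescaling puts the image tree in the unit ball; adding `1` avoids dividing by zero when `J =
  -- 0`.
  set J' : X →L[𝕜] E := (((‖J‖ + 1)⁻¹ : ℝ) : 𝕜) • J with hJ'
  have hnorm : ‖(((‖J‖ + 1)⁻¹ : ℝ) : 𝕜)‖ = (‖J‖ + 1)⁻¹ := by
    rw [RCLike.norm_ofReal, abs_of_pos (by positivity)]
  obtain ⟨t, ht, htC⟩ := hC _ n (fun t => J' (x t)) (fun t h1 h2 => by
    rw [hJ', smul_apply, norm_smul, hnorm, inv_mul_le_iff₀ hpos, mul_one]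
    have := J.le_opNorm_of_le (hx1 t h1 h2)
    linarith) (hx.map J')
  refine ⟨t, ht, (h _).trans (mul_le_mul_of_nonneg_left ?_ hc)⟩
  rwa [branchSum_map, hJ', smul_apply, map_smul, norm_smul, hnorm,
    inv_mul_le_iff₀ hpos] at htC

theorem spaceHasSummableSzlenk_iff :
    SpaceHasSummableSzlenk 𝕜 X ↔ OpHasSummableSzlenk (ContinuousLinearMap.id 𝕜 X) := Iff.rfl

/-- Most branches make all the finitely many coordinates of the branch sum smaller than `1`. -/
theorem spaceHasSummableSzlenk_of_finiteDimensional [FiniteDimensional 𝕜 X] :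
    SpaceHasSummableSzlenk 𝕜 X := by
  rw [spaceHasSummableSzlenk_iff]
  set b := Module.finBasis 𝕜 X
  refine opHasSummableSzlenk_of_tree_bound (∑ i, ‖b i‖) fun n x _ hx => ?_
  have hU := Ultrafilter.of_le (atTop : Filter (WeakNhdsZero 𝕜 X))
  have hev := eventually_all.2 fun i => eventually_norm_apply_branchSum_lt hU
    (LinearMap.toContinuousLinearMap (b.coord i)) n x hx 1 one_pos
  obtain ⟨t, ht, htn⟩ := (hev.and (eventually_length_eq _ n)).exists
  refine ⟨t, htn, ?_⟩
  rw [ContinuousLinearMap.id_apply, ← b.sum_repr (branchSum n x t)]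
  refine norm_sum_le_of_le _ fun i _ => ?_
  rw [norm_smul]
  exact mul_le_of_le_one_left (norm_nonneg _) (ht i).le

end Operators

/-! ### Asymptotic `c₀` spaces -/

section AsymptoticC0

variable {𝕜 : Type v} [RCLike 𝕜] {X : Type u} [NormedAddCommGroup X] [NormedSpace 𝕜 X]

theorem IsAsymptoticC0.spaceHasSummableSzlenk (h : IsAsymptoticC0 𝕜 X) :
    SpaceHasSummableSzlenk 𝕜 X := by
  obtain ⟨-, C, hC1, hC⟩ := h
  refine ⟨8 * (C + 1), by positivity, fun l hl => ?_⟩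
  refine (sum_le_sum_filter_pos l).trans ?_
  rw [← foldr_szlenkDeriv_filter_pos] at hl
  obtain ⟨f, hf⟩ := hl
  set l' := l.filter (0 < ·)
  rcases Nat.eq_zero_or_pos l'.length with h0 | hn
  · rw [List.length_eq_zero_iff] at h0
    rw [h0, List.sum_nil]
    positivity
  obtain ⟨x, hx1, hx, hx2⟩ := exists_tree_of_mem_foldr_szlenkDeriv l'
    (fun ε hε => by simpa using (List.mem_filter.1 hε).2) f hf 0 1 one_pos
  obtain ⟨N, hN, hNc⟩ := exists_mem_asymptoticStructure hn hx1 hx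
  have : Nonempty (Fin l'.length) := ⟨⟨0, hn⟩⟩
  -- The coefficient vector `(1, …, 1)` has maximum norm one, while its norm `N` inherits the lower
  -- bound on branch sums.
  have h1 := hNc 1 (l'.sum / 8 - 1) fun t ht => by
    obtain ⟨g, hg, hle⟩ := hx2 t ht
    rw [zero_add, map_zero, map_zero, zero_add] at hle
    refine hle.trans ((re_apply_le_of_mem_adjointBall
      (A := ContinuousLinearMap.id 𝕜 X) hg _).trans_eq ?_)
    simp [branchSum]
  have h2 := (hC _ hn N hN 1).2
  rw [norm_one, mul_one] at h2
  linarith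

theorem isAsymptoticC0_of_spaceHasSummableSzlenk (hX : ¬ FiniteDimensional 𝕜 X)
    (h : SpaceHasSummableSzlenk 𝕜 X) : IsAsymptoticC0 𝕜 X := by
  obtain ⟨C, hC⟩ := (spaceHasSummableSzlenk_iff.1 h).exists_tree_bound
  refine ⟨hX, 2 * |C| + 6, by linarith [abs_nonneg C], fun n hn N hN => ?_⟩
  -- The lower bound uses only weak nullity and normalisation: branch norms exceed `1 / 3`, halved
  -- by the distortion `b = 2`. Only the upper bound needs the tree estimate, applied to the scaled
  -- tree.
  have hsphere : ∀ a : Fin n → 𝕜, ‖a‖ = 1 → 1 / 6 ≤ N a ∧ N a ≤ 2 * |C| := by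
    intro a ha
    obtain ⟨D, _, _, _, x, hx1, hx, hxN⟩ := hN.2 2 one_lt_two
    rw [weaklyNullTree_iff] at hx
    constructor
    · have hev := eventually_lt_norm_sum_smul (Ultrafilter.of_le (atTop : Filter D)) hx hx1 a
        (r := 1 / 3) hn (by rw [ha]; norm_num)
      obtain ⟨t, ht, htn⟩ := (hev.and (eventually_length_eq _ n)).exists
      have := (hxN a ha t htn).1
      linarith
    · obtain ⟨t, ht, htC⟩ := hC D n (scaleTree a x) (fun t h1 h2 => by
        rw [scaleTree]
        split_ifs with h
        · rw [norm_smul, hx1 t h1 h2, mul_one, ← ha]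
          exact norm_le_pi_norm a _
        · simp) (hx.scaleTree a)
      rw [branchSum_scaleTree a x ht] at htC
      have h1 := (hxN a ha t ht).2
      have h2 := htC.trans (le_abs_self C)
      rw [ContinuousLinearMap.id_apply] at h2
      linarith
  intro a
  rcases eq_or_ne a 0 with rfl | ha
  · simp
  have hpos : 0 < ‖a‖ := norm_pos_iff.2 ha
  have hunit : ‖((‖a‖⁻¹ : ℝ) : 𝕜) • a‖ = 1 := by
    rw [norm_smul, RCLike.norm_ofReal, abs_of_pos (by positivity), inv_mul_cancel₀ hpos.ne']
  obtain ⟨h1, h2⟩ := hsphere _ hunit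
  rw [map_smul_eq_mul, RCLike.norm_ofReal, abs_of_pos (by positivity)] at h1 h2
  rw [inv_mul_le_iff₀ hpos] at h2
  rw [le_inv_mul_iff₀ hpos] at h1
  constructor
  · rw [inv_mul_le_iff₀ (by positivity)]
    nlinarith [abs_nonneg C, apply_nonneg N a]
  · nlinarith [abs_nonneg C]

theorem isAsymptoticC0_iff :
    IsAsymptoticC0 𝕜 X ↔ ¬ FiniteDimensional 𝕜 X ∧ SpaceHasSummableSzlenk 𝕜 X :=
  ⟨fun h => ⟨h.1, h.spaceHasSummableSzlenk⟩,
    fun h => isAsymptoticC0_of_spaceHasSummableSzlenk h.1 h.2⟩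

end AsymptoticC0

/-! ### The injective tensor product -/

section TensorProduct

set_option maxSynthPendingDepth 3

variable {𝕜 : Type*} [RCLike 𝕜]
variable {X₀ X₁ Y₀ Y₁ : Type*} [NormedAddCommGroup X₀] [NormedSpace 𝕜 X₀]
  [NormedAddCommGroup X₁] [NormedSpace 𝕜 X₁]
  [NormedAddCommGroup Y₀] [NormedSpace 𝕜 Y₀]
  [NormedAddCommGroup Y₁] [NormedSpace 𝕜 Y₁]

variable (𝕜 X₀ X₁) in
/-- The inclusion of the injective tensor product into the space of operators. -/
noncomputable def InjTensor.toCLM :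
    InjTensor 𝕜 X₀ X₁ →L[𝕜] (StrongDual 𝕜 X₁ →L[𝕜] X₀) :=
  (injTensorSubmodule 𝕜 X₀ X₁).subtypeL

theorem InjTensor.norm_toCLM (u : InjTensor 𝕜 X₀ X₁) :
    ‖InjTensor.toCLM 𝕜 X₀ X₁ u‖ = ‖u‖ := rfl

theorem InjTensor.toCLM_injective : Function.Injective (InjTensor.toCLM 𝕜 X₀ X₁) :=
  Subtype.val_injective

theorem InjTensor.toCLM_mem_closure (u : InjTensor 𝕜 X₀ X₁) :
    InjTensor.toCLM 𝕜 X₀ X₁ u ∈ closure (Submodule.span 𝕜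
      (Set.range fun p : X₀ × X₁ => elemTensor (𝕜 := 𝕜) p.1 p.2) :
        Set (StrongDual 𝕜 X₁ →L[𝕜] X₀)) :=
  Subtype.property (p := (· ∈ injTensorSubmodule 𝕜 X₀ X₁)) u

theorem InjTensor.toCLM_tensorMap (A₀ : X₀ →L[𝕜] Y₀) (A₁ : X₁ →L[𝕜] Y₁)
    (u : InjTensor 𝕜 X₀ X₁) :
    InjTensor.toCLM 𝕜 Y₀ Y₁ (tensorMap A₀ A₁ u) =
      (A₀.comp (InjTensor.toCLM 𝕜 X₀ X₁ u)).comp (adjointCLM A₁) := rfl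

theorem tensorMap_id :
    tensorMap (ContinuousLinearMap.id 𝕜 X₀) (ContinuousLinearMap.id 𝕜 X₁) =
      ContinuousLinearMap.id 𝕜 (InjTensor 𝕜 X₀ X₁) :=
  ContinuousLinearMap.ext fun _ => InjTensor.toCLM_injective rfl

theorem norm_elemTensor (x₀ : X₀) (x₁ : X₁) : ‖elemTensor (𝕜 := 𝕜) x₀ x₁‖ = ‖x₀‖ * ‖x₁‖ := by
  rw [elemTensor, ContinuousLinearMap.norm_smulRight_apply, mul_comm]
  congr 1
  exact (NormedSpace.inclusionInDoubleDualLi 𝕜 (E := X₁)).norm_map x₁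

theorem elemTensor_mem (x₀ : X₀) (x₁ : X₁) :
    elemTensor (𝕜 := 𝕜) x₀ x₁ ∈ injTensorSubmodule 𝕜 X₀ X₁ :=
  Submodule.le_topologicalClosure _ (Submodule.subset_span ⟨(x₀, x₁), rfl⟩)

/-- The elementary tensor as an element of the injective tensor product. -/
noncomputable def elem (x₀ : X₀) (x₁ : X₁) : InjTensor 𝕜 X₀ X₁ :=
  (⟨elemTensor x₀ x₁, elemTensor_mem x₀ x₁⟩ : injTensorSubmodule 𝕜 X₀ X₁)

theorem norm_elem (x₀ : X₀) (x₁ : X₁) : ‖elem (𝕜 := 𝕜) x₀ x₁‖ = ‖x₀‖ * ‖x₁‖ :=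
  norm_elemTensor x₀ x₁

theorem tensorMap_elem (A₀ : X₀ →L[𝕜] Y₀) (A₁ : X₁ →L[𝕜] Y₁) (x₀ : X₀) (x₁ : X₁) :
    tensorMap A₀ A₁ (elem x₀ x₁) = elem (𝕜 := 𝕜) (A₀ x₀) (A₁ x₁) :=
  InjTensor.toCLM_injective (sandwich_elemTensor A₀ A₁ x₀ x₁)

theorem toCLM_elem_apply (x₀ : X₀) (x₁ : X₁) (f : StrongDual 𝕜 X₁) :
    InjTensor.toCLM 𝕜 X₀ X₁ (elem x₀ x₁) f = f x₁ • x₀ := rfl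

/-- The operator `x₀ ↦ x₀ ⊗ x₁`. -/
noncomputable def elemLeft (x₁ : X₁) : X₀ →L[𝕜] InjTensor 𝕜 X₀ X₁ :=
  LinearMap.mkContinuous
    { toFun := fun x₀ => elem x₀ x₁
      map_add' := fun x y => InjTensor.toCLM_injective <| by
        ext f
        simp only [map_add, add_apply, toCLM_elem_apply, smul_add]
      map_smul' := fun c x => InjTensor.toCLM_injective <| by
        ext f
        simp only [map_smul, smul_apply, toCLM_elem_apply, RingHom.id_apply, smul_comm c] }
    ‖x₁‖ fun x₀ => (norm_elem x₀ x₁).le.trans_eq (mul_comm _ _)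

/-- The operator `x₁ ↦ x₀ ⊗ x₁`. -/
noncomputable def elemRight (x₀ : X₀) : X₁ →L[𝕜] InjTensor 𝕜 X₀ X₁ :=
  LinearMap.mkContinuous
    { toFun := fun x₁ => elem x₀ x₁
      map_add' := fun x y => InjTensor.toCLM_injective <| by
        ext f
        simp only [map_add, add_apply, toCLM_elem_apply, add_smul]
      map_smul' := fun c x => InjTensor.toCLM_injective <| by
        ext f
        simp only [map_smul, smul_apply, toCLM_elem_apply, RingHom.id_apply, smul_assoc] }
    ‖x₀‖ fun x₁ => (norm_elem x₀ x₁).le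

theorem elemLeft_apply (x₀ : X₀) (x₁ : X₁) : elemLeft (𝕜 := 𝕜) x₁ x₀ = elem x₀ x₁ := rfl

theorem elemRight_apply (x₀ : X₀) (x₁ : X₁) : elemRight (𝕜 := 𝕜) x₀ x₁ = elem x₀ x₁ := rfl

theorem OpHasSummableSzlenk.of_tensorMap {A₀ : X₀ →L[𝕜] Y₀} {A₁ : X₁ →L[𝕜] Y₁}
    (h₀ : A₀ ≠ 0) (h₁ : A₁ ≠ 0) (h : OpHasSummableSzlenk (tensorMap A₀ A₁)) :
    OpHasSummableSzlenk A₀ ∧ OpHasSummableSzlenk A₁ := by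
  obtain ⟨x₀, hx₀⟩ := DFunLike.ne_iff.1 h₀
  obtain ⟨x₁, hx₁⟩ := DFunLike.ne_iff.1 h₁
  have hx₀' : 0 < ‖A₀ x₀‖ := norm_pos_iff.2 hx₀
  have hx₁' : 0 < ‖A₁ x₁‖ := norm_pos_iff.2 hx₁
  constructor
  · refine h.of_norm_le (elemLeft x₁) (c := ‖A₁ x₁‖⁻¹) (by positivity) fun x => ?_
    rw [elemLeft_apply, tensorMap_elem, norm_elem, le_inv_mul_iff₀ hx₁', mul_comm]
  · refine h.of_norm_le (elemRight x₀) (c := ‖A₀ x₀‖⁻¹) (by positivity) fun x => ?_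
    rw [elemRight_apply, tensorMap_elem, norm_elem, le_inv_mul_iff₀ hx₀']

/-- The functional `f ⊗ g : u ↦ f (u g)` on the injective tensor product. -/
noncomputable def tensorFunctional (f : WeakDual 𝕜 X₀) (g : WeakDual 𝕜 X₁) :
    StrongDual 𝕜 (InjTensor 𝕜 X₀ X₁) :=
  (WeakDual.toStrongDual f).comp ((ContinuousLinearMap.apply 𝕜 X₀ (WeakDual.toStrongDual g)).comp
    (InjTensor.toCLM 𝕜 X₀ X₁))

theorem tensorFunctional_apply (f : WeakDual 𝕜 X₀) (g : WeakDual 𝕜 X₁)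
    (u : InjTensor 𝕜 X₀ X₁) :
    tensorFunctional f g u = f (InjTensor.toCLM 𝕜 X₀ X₁ u (WeakDual.toStrongDual g)) := rfl

theorem norm_tensorFunctional_sub_le (f f' : WeakDual 𝕜 X₀) (g g' : WeakDual 𝕜 X₁) :
    ‖tensorFunctional f g - tensorFunctional f' g'‖ ≤
      ‖WeakDual.toStrongDual f - WeakDual.toStrongDual f'‖ * ‖WeakDual.toStrongDual g‖ +
        ‖WeakDual.toStrongDual f'‖ * ‖WeakDual.toStrongDual g - WeakDual.toStrongDual g'‖ := by
  refine ContinuousLinearMap.opNorm_le_bound _ (by positivity) fun u => ?_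
  have heq : (tensorFunctional f g - tensorFunctional f' g') u =
      (WeakDual.toStrongDual f - WeakDual.toStrongDual f')
        (InjTensor.toCLM 𝕜 X₀ X₁ u (WeakDual.toStrongDual g)) +
      WeakDual.toStrongDual f' (InjTensor.toCLM 𝕜 X₀ X₁ u
        (WeakDual.toStrongDual g - WeakDual.toStrongDual g')) := by
    simp [tensorFunctional_apply]
  have hb : ∀ (φ : StrongDual 𝕜 X₀) (ψ : StrongDual 𝕜 X₁),
      ‖φ (InjTensor.toCLM 𝕜 X₀ X₁ u ψ)‖ ≤ ‖φ‖ * ‖ψ‖ * ‖u‖ := fun φ ψ => by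
    refine (φ.le_opNorm_of_le (ContinuousLinearMap.le_opNorm _ ψ)).trans_eq ?_
    rw [InjTensor.norm_toCLM]
    ring
  rw [heq, add_mul]
  exact (norm_add_le _ _).trans (add_le_add (hb _ _) (hb _ _))

/-- Joint weak-star continuity is clear for elementary tensors and passes to their span; on bounded
sets norm approximation is uniform approximation, which gives the closure. -/
theorem continuousOn_apply_of_mem_closure {K₀ : Set (WeakDual 𝕜 X₀)} {K₁ : Set (WeakDual 𝕜 X₁)}
    {R₀ R₁ : ℝ} (hK₀ : ∀ f ∈ K₀, ‖WeakDual.toStrongDual f‖ ≤ R₀)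
    (hK₁ : ∀ g ∈ K₁, ‖WeakDual.toStrongDual g‖ ≤ R₁) (hR₀ : 0 ≤ R₀) (hR₁ : 0 ≤ R₁)
    {u : StrongDual 𝕜 X₁ →L[𝕜] X₀}
    (hu : u ∈ closure (Submodule.span 𝕜
      (Set.range fun p : X₀ × X₁ => elemTensor (𝕜 := 𝕜) p.1 p.2) :
        Set (StrongDual 𝕜 X₁ →L[𝕜] X₀))) :
    ContinuousOn (fun p : WeakDual 𝕜 X₀ × WeakDual 𝕜 X₁ => p.1 (u (WeakDual.toStrongDual p.2)))
      (K₀ ×ˢ K₁) := by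
  have hspan : ∀ v ∈ Submodule.span 𝕜
      (Set.range fun p : X₀ × X₁ => elemTensor (𝕜 := 𝕜) p.1 p.2),
      Continuous fun p : WeakDual 𝕜 X₀ × WeakDual 𝕜 X₁ =>
        p.1 (v (WeakDual.toStrongDual p.2)) := by
    intro v hv
    induction hv using Submodule.span_induction with
    | mem v hv =>
      obtain ⟨⟨x₀, x₁⟩, rfl⟩ := hv
      have h : Continuous fun p : WeakDual 𝕜 X₀ × WeakDual 𝕜 X₁ => p.2 x₁ * p.1 x₀ :=
        ((WeakDual.eval_continuous x₁).comp continuous_snd).mul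
          ((WeakDual.eval_continuous x₀).comp continuous_fst)
      refine h.congr fun p => ?_
      exact (map_smul p.1 (p.2 x₁) x₀).symm
    | zero => simpa using continuous_const
    | add v w _ _ hv hw => exact (hv.add hw).congr fun p => by simp
    | smul c v _ hv => simpa using hv.const_mul c
  refine continuousOn_of_uniform_approx_of_continuousOn fun W hW => ?_
  obtain ⟨ε, hε, hεW⟩ := Metric.mem_uniformity_dist.1 hW
  obtain ⟨v, hv, huv⟩ := Metric.mem_closure_iff.1 hu (ε / (R₀ * R₁ + 1)) (by positivity)
  refine ⟨_, (hspan v hv).continuousOn, fun p hp => hεW ?_⟩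
  rw [dist_eq_norm, lt_div_iff₀ (by positivity)] at huv
  have heq : p.1 (u (WeakDual.toStrongDual p.2)) - p.1 (v (WeakDual.toStrongDual p.2)) =
      WeakDual.toStrongDual p.1 ((u - v) (WeakDual.toStrongDual p.2)) := by simp
  rw [dist_eq_norm, heq]
  calc _ ≤ R₀ * (‖u - v‖ * R₁) := ContinuousLinearMap.le_of_opNorm_le_of_le _ (hK₀ _ hp.1)
        (ContinuousLinearMap.le_opNorm_of_le _ (hK₁ _ hp.2))
    _ < ε := by nlinarith [norm_nonneg (u - v)]

/-- The operator norm of `A₀ u A₁^*` is computed by functionals `f ⊗ g` with `f`, `g` in the two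
adjoint balls: the injective norm is what makes such pairs norming. -/
theorem norm_tensorMap_le {A₀ : X₀ →L[𝕜] Y₀} {A₁ : X₁ →L[𝕜] Y₁} {u : InjTensor 𝕜 X₀ X₁} {C : ℝ}
    (hC : 0 ≤ C) (h : ∀ f ∈ adjointBall A₀, ∀ g ∈ adjointBall A₁,
      RCLike.re (tensorFunctional f g u) ≤ C) : ‖tensorMap A₀ A₁ u‖ ≤ C := by
  rw [← InjTensor.norm_toCLM, InjTensor.toCLM_tensorMap]
  refine ContinuousLinearMap.opNorm_le_of_unit_norm hC fun g hg => ?_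
  change ‖A₀ (InjTensor.toCLM 𝕜 X₀ X₁ u (adjointCLM A₁ g))‖ ≤ C
  exact norm_le_of_forall_mem_adjointBall fun f hf =>
    h f hf _ (mem_adjointBall.2 ⟨g, hg.le, rfl⟩)

theorem OpHasSummableSzlenk.tensorMap {A₀ : X₀ →L[𝕜] Y₀} {A₁ : X₁ →L[𝕜] Y₁}
    (h₀ : OpHasSummableSzlenk A₀) (h₁ : OpHasSummableSzlenk A₁) :
    OpHasSummableSzlenk (tensorMap A₀ A₁) := by
  obtain ⟨M₀, hM₀, hM₀'⟩ := h₀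
  obtain ⟨M₁, hM₁, hM₁'⟩ := h₁
  refine opHasSummableSzlenk_of_tree_bound
    ((‖A₀‖ + ‖A₁‖) * (M₀ + M₁) + 2 * (‖A₀‖ + ‖A₁‖) + 1) fun n x hx1 hx => ?_
  obtain ⟨t, ht, h⟩ := exists_branch_re_le (isCompact_adjointBall A₀) (isCompact_adjointBall A₁)
    hM₀' hM₁' (T := tensorFunctional) (R := ‖A₀‖ + ‖A₁‖) (by positivity)
    (fun f hf f' hf' g hg g' hg' => by
      refine (norm_tensorFunctional_sub_le f f' g g').trans ?_
      have h1 := norm_le_of_mem_adjointBall hf'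
      have h2 := norm_le_of_mem_adjointBall hg
      have h3 := norm_nonneg (WeakDual.toStrongDual f - WeakDual.toStrongDual f')
      have h4 := norm_nonneg (WeakDual.toStrongDual g - WeakDual.toStrongDual g')
      nlinarith [norm_nonneg A₀, norm_nonneg A₁])
    (fun u => continuousOn_apply_of_mem_closure (fun f hf => norm_le_of_mem_adjointBall hf)
      (fun g hg => norm_le_of_mem_adjointBall hg) (norm_nonneg _) (norm_nonneg _)
      u.toCLM_mem_closure) hx1 hx
  exact ⟨t, ht, norm_tensorMap_le (by positivity) h⟩

theorem id_ne_zero_of_nontrivial [Nontrivial X₀] : ContinuousLinearMap.id 𝕜 X₀ ≠ 0 := by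
  obtain ⟨x, hx⟩ := exists_ne (0 : X₀)
  exact fun h => hx (DFunLike.congr_fun h x)

theorem spaceHasSummableSzlenk_injTensor_iff [Nontrivial X₀] [Nontrivial X₁] :
    SpaceHasSummableSzlenk 𝕜 (InjTensor 𝕜 X₀ X₁) ↔
      SpaceHasSummableSzlenk 𝕜 X₀ ∧ SpaceHasSummableSzlenk 𝕜 X₁ := by
  simp only [spaceHasSummableSzlenk_iff, ← tensorMap_id]
  exact ⟨OpHasSummableSzlenk.of_tensorMap id_ne_zero_of_nontrivial id_ne_zero_of_nontrivial,
    fun h => h.1.tensorMap h.2⟩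

/-- Tensoring with a fixed nonzero vector is injective, because the norm of an elementary tensor is
the product of the norms. -/
theorem not_finiteDimensional_injTensor [Nontrivial X₀] [Nontrivial X₁]
    (h : ¬ FiniteDimensional 𝕜 X₀ ∨ ¬ FiniteDimensional 𝕜 X₁) :
    ¬ FiniteDimensional 𝕜 (InjTensor 𝕜 X₀ X₁) := by
  intro hfin
  obtain ⟨x₀, hx₀⟩ := exists_ne (0 : X₀)
  obtain ⟨x₁, hx₁⟩ := exists_ne (0 : X₁)
  have hzero : ∀ (y₀ : X₀) (y₁ : X₁), elem (𝕜 := 𝕜) y₀ y₁ = 0 → y₀ = 0 ∨ y₁ = 0 := by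
    intro y₀ y₁ hy
    have := norm_elem (𝕜 := 𝕜) y₀ y₁
    rw [hy, norm_zero, eq_comm, mul_eq_zero, norm_eq_zero, norm_eq_zero] at this
    exact this
  rcases h with h | h
  · refine h (FiniteDimensional.of_injective (elemLeft (𝕜 := 𝕜) (X₀ := X₀) x₁).toLinearMap
      ((injective_iff_map_eq_zero _).2 fun y hy => ?_))
    exact (hzero y x₁ hy).resolve_right hx₁
  · refine h (FiniteDimensional.of_injective (elemRight (𝕜 := 𝕜) (X₁ := X₁) x₀).toLinearMap
      ((injective_iff_map_eq_zero _).2 fun y hy => ?_))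
    exact (hzero x₀ y hy).resolve_left hx₀

end TensorProduct

end SummableSzlenk

theorem mainTheorem3 {𝕜 : Type*} [RCLike 𝕜]
    {X₀ X₁ Y₀ Y₁ : Type*}
    [NormedAddCommGroup X₀] [NormedSpace 𝕜 X₀] [CompleteSpace X₀]
    [NormedAddCommGroup X₁] [NormedSpace 𝕜 X₁] [CompleteSpace X₁]
    [NormedAddCommGroup Y₀] [NormedSpace 𝕜 Y₀] [CompleteSpace Y₀]
    [NormedAddCommGroup Y₁] [NormedSpace 𝕜 Y₁] [CompleteSpace Y₁]
    (A₀ : X₀ →L[𝕜] Y₀) (A₁ : X₁ →L[𝕜] Y₁) :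
    -- operators
    (SummableSzlenk.OpHasSummableSzlenk A₀ → SummableSzlenk.OpHasSummableSzlenk A₁ →
      SummableSzlenk.OpHasSummableSzlenk (SummableSzlenk.tensorMap A₀ A₁)) ∧
    (A₀ ≠ 0 → A₁ ≠ 0 →
      SummableSzlenk.OpHasSummableSzlenk (SummableSzlenk.tensorMap A₀ A₁) →
      SummableSzlenk.OpHasSummableSzlenk A₀ ∧ SummableSzlenk.OpHasSummableSzlenk A₁) ∧
    -- spaces
    (Nontrivial X₀ → Nontrivial X₁ →
      (SummableSzlenk.SpaceHasSummableSzlenk 𝕜 (SummableSzlenk.InjTensor 𝕜 X₀ X₁) ↔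
        SummableSzlenk.SpaceHasSummableSzlenk 𝕜 X₀ ∧
        SummableSzlenk.SpaceHasSummableSzlenk 𝕜 X₁) ∧
      (¬ FiniteDimensional 𝕜 X₀ ∨ ¬ FiniteDimensional 𝕜 X₁ →
        (SummableSzlenk.IsAsymptoticC0 𝕜 (SummableSzlenk.InjTensor 𝕜 X₀ X₁) ↔
          SummableSzlenk.SpaceHasSummableSzlenk 𝕜 (SummableSzlenk.InjTensor 𝕜 X₀ X₁)) ∧
        (SummableSzlenk.IsAsymptoticC0 𝕜 (SummableSzlenk.InjTensor 𝕜 X₀ X₁) ↔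
          (¬ FiniteDimensional 𝕜 X₀ → SummableSzlenk.IsAsymptoticC0 𝕜 X₀) ∧
          (¬ FiniteDimensional 𝕜 X₁ → SummableSzlenk.IsAsymptoticC0 𝕜 X₁)))) := by
  refine ⟨fun h₀ h₁ => h₀.tensorMap h₁, fun h₀ h₁ h => h.of_tensorMap h₀ h₁, fun _ _ =>
    ⟨SummableSzlenk.spaceHasSummableSzlenk_injTensor_iff, fun hdim => ?_⟩⟩
  have hT := SummableSzlenk.not_finiteDimensional_injTensor hdim
  have hiff : SummableSzlenk.IsAsymptoticC0 𝕜 (SummableSzlenk.InjTensor 𝕜 X₀ X₁) ↔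
      SummableSzlenk.SpaceHasSummableSzlenk 𝕜 (SummableSzlenk.InjTensor 𝕜 X₀ X₁) := by
    rw [SummableSzlenk.isAsymptoticC0_iff, and_iff_right hT]
  refine ⟨hiff, ?_⟩
  rw [hiff, SummableSzlenk.spaceHasSummableSzlenk_injTensor_iff,
    SummableSzlenk.isAsymptoticC0_iff, SummableSzlenk.isAsymptoticC0_iff]
  -- A finite-dimensional factor imposes no condition, as it always has summable Szlenk index.
  refine and_congr ⟨fun h hd => ⟨hd, h⟩, fun h => ?_⟩ ⟨fun h hd => ⟨hd, h⟩, fun h => ?_⟩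
  · by_cases hd : FiniteDimensional 𝕜 X₀
    · exact SummableSzlenk.spaceHasSummableSzlenk_of_finiteDimensional
    · exact (h hd).2
  · by_cases hd : FiniteDimensional 𝕜 X₁
    · exact SummableSzlenk.spaceHasSummableSzlenk_of_finiteDimensional
    · exact (h hd).2
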